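/- **Lemma.** All measures are Borel measures on $\mathbb R$. Write $\mu\le_c\nu$ if $\mu,\nu$ are finite measures with finite first moments and $\mu(\phi)\le\nu(\phi)$ for every convex $\phi:\mathbb R\to\mathbb R$, where $\mu(\phi)=\int\phi\,d\mu$. Put $u_\mu(x)=\int|x-y|\,\mu(dy)$. Let $\mu\le_c\nu$ be irreducible: the set $I=\{u_\mu<u_\nu\}$ is connected and $\mu(I)=\mu(\mathbb R)$. Let $J$ be the union of $I$ and those endpoints of $I$ that are atoms of $\nu$. For concave $\chi:J\to\mathbb R$ set $$(\mu-\nu)(\chi)=\tfrac12\int_I(u_\mu-u_\nu)\,d\chi''+\int_{J\setminus I}|\Delta\chi|\,d(\nu-\mu)\in[0,\infty],$$ where $-\chi''$ is the second derivative measure on $I$ of the convex function $-\chi$ and $\Delta\chi$ is the jump of $\chi$ at an endpoint of $I$. For Borel functions $\varphi,\psi:J\to[-\infty,\infty]$, a concave moderator is a concave $\chi:J\to\mathbb R$ with $\varphi-\chi\in L^1(\mu)$ and $\psi+\chi\in L^1(\nu)$; if one exists, set $$\mu(\varphi)+\nu(\psi):=\mu(\varphi-\chi)+\nu(\psi+\chi)+(\mu-\nu)(\chi)\in(-\infty,\infty],$$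 which does not depend on the choice of $\chi$. Let $L^c(\mu,\nu)$ be the set of pairs $(\varphi,\psi)$ of Borel functions $J\to[-\infty,\infty]$ that admit a concave moderator $\chi$ with $(\mu-\nu)(\chi)<\infty$. For $f:\mathbb R\to[0,\infty]$ define the auxiliary primal and dual values $$\widetilde{\mathbf S}_{\mu,\nu}(f)=\sup_{\mu\le_c\theta\le_c\nu}\theta(f),\qquad \widetilde{\mathbf I}_{\mu,\nu}(f)=\inf_{(\varphi,\psi)}\{\mu(\varphi)+\nu(\psi)\},$$ where $\theta(f)$ is the integral of $f$ (the outer integral if $f$ is not Borel), and the infimum is over all $(\varphi,\psi)\in L^c(\mu,\nu)$ with $\varphi$ concave, $\psi$ convex and $\varphi+\psi\ge f$ on $J$ (in particular, this sum is required to be well defined on $J$). If $f:\mathbb R\to[0,\infty]$ is bounded and upper semicontinuous, then $$\widetilde{\mathbf S}_{\mu,\nu}(f)=\widetilde{\mathbf I}_{\mu,\nu}(f).$$ -/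

import Mathlib

open MeasureTheory Set Filter Topology
open scoped ENNReal NNReal

noncomputable section

namespace ConvexOrderDuality

/-- The integral `μ(g) = μ(g⁺) - μ(g⁻)` with values in `[-∞, ∞]`. It is used where `g⁻` has a finite
integral, so that the difference is not of the form `∞ - ∞`. -/
def extIntegral (μ : Measure ℝ) (g : ℝ → ℝ) : EReal :=
  ((∫⁻ x, ENNReal.ofReal (g x) ∂μ : ℝ≥0∞) : EReal) -
    ((∫⁻ x, ENNReal.ofReal (-g x) ∂μ : ℝ≥0∞) : EReal)

/-- `μ ≤_c ν`: both measures are finite with finite first moment, and `μ(φ) ≤ ν(φ)` for every convex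
`φ : ℝ → ℝ`. Both sides are well defined in `(-∞, ∞]` because `φ` has an affine minorant. -/
structure ConvexOrder (μ ν : Measure ℝ) : Prop where
  finite_left : IsFiniteMeasure μ
  finite_right : IsFiniteMeasure ν
  moment_left : Integrable (fun x : ℝ => x) μ
  moment_right : Integrable (fun x : ℝ => x) ν
  le : ∀ φ : ℝ → ℝ, ConvexOn ℝ univ φ → extIntegral μ φ ≤ extIntegral ν φ

/-- The potential function `u_μ(x) = ∫ |x - y| μ(dy)` of a finite measure with finite first moment. -/
def potential (μ : Measure ℝ) (x : ℝ) : ℝ := ∫ y, |x - y| ∂μ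

/-- `I = {u_μ < u_ν}`. -/
def domI (μ ν : Measure ℝ) : Set ℝ := {x | potential μ x < potential ν x}

/-- `J` is the union of `I` and the endpoints of `I` that are atoms of `ν`. -/
def domJ (μ ν : Measure ℝ) : Set ℝ :=
  domI μ ν ∪ {x | x ∈ frontier (domI μ ν) ∧ ν {x} ≠ 0}

/-- The pair `μ ≤_c ν` is irreducible (with domain `(domI μ ν, domJ μ ν)`). -/
structure Irreducible (μ ν : Measure ℝ) : Prop where
  order : ConvexOrder μ ν
  connected : IsPreconnected (domI μ ν)
  concentrated : μ (domI μ ν) = μ univ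

/-- The right derivative. -/
def rightDeriv (χ : ℝ → ℝ) (x : ℝ) : ℝ := derivWithin χ (Ioi x) x

/-- `m` is the second derivative measure `-χ''` on `I` of the convex function `-χ`: it lives on `I` and
`m (a, b] = χ'(a+) - χ'(b+)` for `a < b` in `I`. -/
def IsNegSecondDeriv (I : Set ℝ) (χ : ℝ → ℝ) (m : Measure ℝ) : Prop :=
  m Iᶜ = 0 ∧ ∀ a ∈ I, ∀ b ∈ I, a < b →
    m (Ioc a b) = ENNReal.ofReal (rightDeriv χ a - rightDeriv χ b)

/-- On an open interval on which `g` is monotone and right-continuous, `g` has a Stieltjes measure. -/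
theorem exists_stieltjes {I : Set ℝ} (hI : IsOpen I) (hc : I.OrdConnected) {g : ℝ → ℝ}
    (hg : MonotoneOn g I)
    (hr : ∀ x ∈ I, ∀ c, g x < c → ∃ y ∈ I, x < y ∧ g y < c) :
    ∃ m : Measure ℝ, m Iᶜ = 0 ∧
      ∀ a ∈ I, ∀ b ∈ I, a < b → m (Ioc a b) = ENNReal.ofReal (g b - g a) := by
  set P : Set ℝ := {p | (∃ x ∈ I, p ≤ g x) ∧ ∃ y ∈ I, g y < p} with hP
  set q : ℝ → ℝ := fun p => sInf {x | x ∈ I ∧ p ≤ g x} with hq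
  have hlow : ∀ p, ∀ y ∈ I, g y < p → ∀ x, x ∈ I → p ≤ g x → y ≤ x := by
    intro p y hy hyp x hx hpx
    by_contra hlt
    exact absurd (hg hx hy (not_le.1 hlt).le) (not_le.2 (hyp.trans_le hpx))
  have hbdd : ∀ p ∈ P, BddBelow {x | x ∈ I ∧ p ≤ g x} := by
    rintro p ⟨-, y, hy, hyp⟩
    exact ⟨y, fun x hx => hlow p y hy hyp x hx.1 hx.2⟩
  have hne : ∀ p ∈ P, {x | x ∈ I ∧ p ≤ g x}.Nonempty := by
    rintro p ⟨⟨x, hx, hpx⟩, -⟩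
    exact ⟨x, hx, hpx⟩
  have hqI : ∀ p ∈ P, q p ∈ I := by
    intro p hp
    obtain ⟨⟨x, hx, hpx⟩, y, hy, hyp⟩ := id hp
    exact hc.out hy hx ⟨le_csInf (hne p hp) fun z hz => hlow p y hy hyp z hz.1 hz.2,
      csInf_le (hbdd p hp) ⟨hx, hpx⟩⟩
  have hqle : ∀ p ∈ P, ∀ b ∈ I, q p ≤ b ↔ p ≤ g b := by
    intro p hp b hb
    refine ⟨fun h => ?_, fun h => csInf_le (hbdd p hp) ⟨hb, h⟩⟩
    by_contra hlt
    obtain ⟨y, hy, hby, hyp⟩ := hr b hb p (not_le.1 hlt)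
    obtain ⟨x, hx, hxy⟩ := exists_lt_of_csInf_lt (hne p hp) (h.trans_lt hby)
    exact absurd (hg hx.1 hy hxy.le) (not_le.2 (hyp.trans_le hx.2))
  have hPm : MeasurableSet P := by
    refine OrdConnected.measurableSet ⟨fun a ha b hb p hp => ?_⟩
    obtain ⟨-, y, hy, hya⟩ := ha
    obtain ⟨⟨x, hx, hbx⟩, -⟩ := hb
    exact ⟨⟨x, hx, hp.2.trans hbx⟩, y, hy, hya.trans_le hp.1⟩
  have hqmono : MonotoneOn q P := by
    intro p hp p' hp' hpp
    exact csInf_le_csInf (hbdd p hp) (hne p' hp') fun x hx => ⟨hx.1, hpp.trans hx.2⟩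
  have hqm : AEMeasurable q (volume.restrict P) := aemeasurable_restrict_of_monotoneOn hPm hqmono
  refine ⟨(volume.restrict P).map q, ?_, fun a ha b hb hab => ?_⟩
  · rw [Measure.map_apply_of_aemeasurable hqm hI.measurableSet.compl, Measure.restrict_apply' hPm]
    convert measure_empty (μ := (volume : Measure ℝ))
    ext p
    simp only [mem_inter_iff, mem_preimage, mem_compl_iff, mem_empty_iff_false, iff_false]
    exact fun h => h.1 (hqI p h.2)
  · rw [Measure.map_apply_of_aemeasurable hqm measurableSet_Ioc, Measure.restrict_apply' hPm,
      ← Real.volume_Ioc]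
    congr 1
    ext p
    simp only [mem_inter_iff, mem_preimage, mem_Ioc]
    constructor
    · rintro ⟨⟨h1, h2⟩, hp⟩
      exact ⟨not_le.1 fun h => absurd ((hqle p hp a ha).2 h) (not_le.2 h1), (hqle p hp b hb).1 h2⟩
    · rintro ⟨h1, h2⟩
      have hp : p ∈ P := ⟨⟨b, hb, h2⟩, a, ha, h1⟩
      exact ⟨⟨not_le.1 fun h => absurd ((hqle p hp a ha).1 h) (not_le.2 h1), (hqle p hp b hb).2 h2⟩, hp⟩

/-- The measure `-χ''` exists for every concave function on an open interval. -/
theorem exists_isNegSecondDeriv {I : Set ℝ} (hI : IsOpen I) {χ : ℝ → ℝ} (hχ : ConcaveOn ℝ I χ) :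
    ∃ m, IsNegSecondDeriv I χ m := by
  have hcv : ConvexOn ℝ I (-χ) := hχ.neg
  have hd : ∀ x, derivWithin (-χ) (Ioi x) x = -rightDeriv χ x := by
    intro x
    rw [rightDeriv, ← derivWithin.neg]
  have hmono : MonotoneOn (fun x => -rightDeriv χ x) I := by
    have := hcv.monotoneOn_rightDeriv
    rw [hI.interior_eq] at this
    simpa only [hd] using this
  obtain ⟨m, h0, h1⟩ := exists_stieltjes hI hχ.1.ordConnected hmono (by
    intro x hx c hxc
    have hder := hcv.hasDerivWithinAt_rightDeriv_of_mem_interior (x := x) (by rwa [hI.interior_eq])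
    rw [hd] at hder
    have hslope := (hasDerivWithinAt_iff_tendsto_slope' (self_notMem_Ioi)).1 hder
    have hev : ∀ᶠ y in 𝓝[>] x, slope (-χ) x y < c := hslope.eventually (gt_mem_nhds hxc)
    have hevI : ∀ᶠ y in 𝓝[>] x, y ∈ I := nhdsWithin_le_nhds (hI.mem_nhds hx)
    obtain ⟨y, hy, hyI, hxy⟩ := (hev.and (hevI.and self_mem_nhdsWithin)).exists
    have hcont : ContinuousAt (-χ) x := (hcv.continuousOn hI).continuousAt (hI.mem_nhds hx)
    have hne : y - x ≠ 0 := sub_ne_zero.2 (ne_of_gt hxy)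
    have hsc : ContinuousAt (fun z => ((-χ) y - (-χ) z) / (y - z)) x :=
      (continuousAt_const.sub hcont).div (continuousAt_const.sub continuousAt_id) hne
    have hy' : ((-χ) y - (-χ) x) / (y - x) < c := by rwa [slope_def_field] at hy
    have hev2 : ∀ᶠ z in 𝓝[>] x, ((-χ) y - (-χ) z) / (y - z) < c :=
      nhdsWithin_le_nhds (hsc.eventually (gt_mem_nhds hy'))
    have hev3 : ∀ᶠ z in 𝓝[>] x, z < y := nhdsWithin_le_nhds (gt_mem_nhds hxy)
    obtain ⟨z, hz, hzy, hzI, hxz⟩ :=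
      (hev2.and (hev3.and (hevI.and self_mem_nhdsWithin))).exists
    refine ⟨z, hzI, hxz, ?_⟩
    have := hcv.rightDeriv_le_slope_of_mem_interior (by rwa [hI.interior_eq]) hyI hzy
    rw [hd, slope_def_field] at this
    exact this.trans_lt hz)
  refine ⟨m, h0, fun a ha b hb hab => ?_⟩
  rw [h1 a ha b hb hab]
  congr 1
  ring

/-- The measure `-χ''` is unique. -/
theorem IsNegSecondDeriv.unique {I : Set ℝ} (hI : IsOpen I) {χ : ℝ → ℝ} {m m' : Measure ℝ}
    (hm : IsNegSecondDeriv I χ m) (hm' : IsNegSecondDeriv I χ m') (hc : I.OrdConnected) : m = m' := by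
  have key : ∀ p : ℚ × ℚ, (p.1 : ℝ) ∈ I → (p.2 : ℝ) ∈ I →
      m.restrict (Ioc (p.1 : ℝ) p.2) = m'.restrict (Ioc (p.1 : ℝ) p.2) := by
    rintro ⟨a, b⟩ ha hb
    have hsub : ∀ c d : ℝ, m (Ioc c d ∩ Ioc (a : ℝ) b) = m' (Ioc c d ∩ Ioc (a : ℝ) b) := by
      intro c d
      rw [Ioc_inter_Ioc]
      rcases le_or_gt (min d (b : ℝ)) (max c (a : ℝ)) with h | h
      · rw [Ioc_eq_empty (not_lt.2 h)]; simp
      · have h1 : max c (a : ℝ) ∈ I :=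
          hc.out ha hb ⟨le_max_right _ _, h.le.trans (min_le_right _ _)⟩
        have h2 : min d (b : ℝ) ∈ I :=
          hc.out ha hb ⟨(le_max_right _ _).trans h.le, min_le_right _ _⟩
        rw [hm.2 _ h1 _ h2 h, hm'.2 _ h1 _ h2 h]
    refine Measure.ext_of_Ioc' _ _ (fun c d _ => ?_) (fun c d _ => ?_)
    · rw [Measure.restrict_apply measurableSet_Ioc]
      refine ((measure_mono inter_subset_right).trans_lt ?_).ne
      rcases le_or_gt (b : ℝ) a with h | h
      · rw [Ioc_eq_empty (not_lt.2 h)]; simp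
      · rw [hm.2 _ ha _ hb h]; exact ENNReal.ofReal_lt_top
    · rw [Measure.restrict_apply measurableSet_Ioc, Measure.restrict_apply measurableSet_Ioc, hsub]
  let ι := {p : ℚ × ℚ // (p.1 : ℝ) ∈ I ∧ (p.2 : ℝ) ∈ I}
  have hcov : I = ⋃ p : ι, Ioc (p.1.1 : ℝ) p.1.2 := by
    ext x
    simp only [mem_iUnion]
    constructor
    · intro hx
      obtain ⟨l, u, ⟨hl, hu⟩, hlu⟩ := mem_nhds_iff_exists_Ioo_subset.1 (hI.mem_nhds hx)
      obtain ⟨a, ha1, ha2⟩ := exists_rat_btwn hl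
      obtain ⟨b, hb1, hb2⟩ := exists_rat_btwn hu
      exact ⟨⟨(a, b), hlu ⟨ha1, ha2.trans hu⟩, hlu ⟨hl.trans hb1, hb2⟩⟩, ha2, hb1.le⟩
    · rintro ⟨p, hp⟩
      exact hc.out p.2.1 p.2.2 ⟨hp.1.le, hp.2⟩
  have hres : m.restrict I = m'.restrict I := by
    rw [hcov, Measure.restrict_iUnion_congr]
    exact fun p => key p.1 p.2.1 p.2.2
  rwa [Measure.restrict_eq_self_of_ae_mem (show ∀ᵐ x ∂m, x ∈ I from hm.1),
    Measure.restrict_eq_self_of_ae_mem (show ∀ᵐ x ∂m', x ∈ I from hm'.1)] at hres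

open Classical in
/-- The second derivative measure `-χ''` on `I` (`0` if there is none, which does not occur for a
concave `χ` on an open interval `I`). -/
def negSecondDeriv (I : Set ℝ) (χ : ℝ → ℝ) : Measure ℝ :=
  if h : ∃ m, IsNegSecondDeriv I χ m then h.choose else 0

theorem negSecondDeriv_spec {I : Set ℝ} (hI : IsOpen I) {χ : ℝ → ℝ} (hχ : ConcaveOn ℝ I χ) :
    IsNegSecondDeriv I χ (negSecondDeriv I χ) := by
  have h := exists_isNegSecondDeriv hI hχ
  rw [negSecondDeriv, dif_pos h]
  exact h.choose_spec

/-- The size `|Δχ(b)| = |χ(b) - lim_{x → b, x ∈ I} χ(x)|` of the jump of `χ` at an endpoint `b` of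
`I`. -/
def jump (I : Set ℝ) (χ : ℝ → ℝ) (b : ℝ) : ℝ := |χ b - limUnder (𝓝[I] b) χ|

/-- `(θ₁ - θ₂)(χ) = ½ ∫_I (u_{θ₁} - u_{θ₂}) dχ'' + ∫_{J \ I} |Δχ| d(θ₂ - θ₁)`, in `[0, ∞]`, for a
concave function `χ` on `J`. The integrals over the at most two points of `J \ I` are finite and
`θ₁ ≤ θ₂` there, so that the subtraction in `[0, ∞]` is the ordinary one. -/
def concaveIntegral (I J : Set ℝ) (θ₁ θ₂ : Measure ℝ) (χ : ℝ → ℝ) : ℝ≥0∞ :=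
  2⁻¹ * (∫⁻ x in I, ENNReal.ofReal (potential θ₂ x - potential θ₁ x) ∂(negSecondDeriv I χ)) +
    ((∫⁻ x in J \ I, ENNReal.ofReal (jump I χ x) ∂θ₂) -
      ∫⁻ x in J \ I, ENNReal.ofReal (jump I χ x) ∂θ₁)

/-- `g : J → [-∞, ∞]` belongs to `L¹(θ)`, where `θ` is concentrated on `J`. -/
def IntegrableOnJ (J : Set ℝ) (θ : Measure ℝ) (g : ℝ → EReal) : Prop :=
  (∀ᵐ x ∂θ.restrict J, g x ≠ ⊤ ∧ g x ≠ ⊥) ∧ IntegrableOn (fun x => (g x).toReal) J θ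

/-- `χ` is a concave moderator for `(φ, ψ)` with respect to `θ₁ ≤_c θ₂`. -/
structure IsModerator (J : Set ℝ) (θ₁ θ₂ : Measure ℝ) (φ ψ : ℝ → EReal) (χ : ℝ → ℝ) : Prop where
  concave : ConcaveOn ℝ J χ
  integrable_left : IntegrableOnJ J θ₁ (fun x => φ x - (χ x : EReal))
  integrable_right : IntegrableOnJ J θ₂ (fun x => ψ x + (χ x : EReal))

/-- `θ₁(φ - χ) + θ₂(ψ + χ) + (θ₁ - θ₂)(χ)`. -/
def moderatedValue (I J : Set ℝ) (θ₁ θ₂ : Measure ℝ) (φ ψ : ℝ → EReal) (χ : ℝ → ℝ) : EReal :=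
  ((∫ x in J, (φ x - (χ x : EReal)).toReal ∂θ₁ : ℝ) : EReal) +
    ((∫ x in J, (ψ x + (χ x : EReal)).toReal ∂θ₂ : ℝ) : EReal) +
    ((concaveIntegral I J θ₁ θ₂ χ : ℝ≥0∞) : EReal)

/-- The generalized integral `θ₁(φ) + θ₂(ψ)`. The value `moderatedValue` is the same for all concave
moderators `χ`; the infimum over `χ` only selects this common value. -/
def generalizedIntegral (I J : Set ℝ) (θ₁ θ₂ : Measure ℝ) (φ ψ : ℝ → EReal) : EReal :=
  ⨅ (χ : ℝ → ℝ) (_ : IsModerator J θ₁ θ₂ φ ψ χ), moderatedValue I J θ₁ θ₂ φ ψ χ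

/-- `(φ, ψ) ∈ L^c(θ₁, θ₂)`. Functions on `J` are represented by functions on `ℝ` whose values outside
`J` play no role. -/
structure MemLc (I J : Set ℝ) (θ₁ θ₂ : Measure ℝ) (φ ψ : ℝ → EReal) : Prop where
  measurable_left : Measurable (fun x : J => φ x)
  measurable_right : Measurable (fun x : J => ψ x)
  exists_moderator : ∃ χ : ℝ → ℝ, IsModerator J θ₁ θ₂ φ ψ χ ∧ concaveIntegral I J θ₁ θ₂ χ < ⊤

/-- A function `J → [-∞, ∞]` is convex if its epigraph is convex. -/
def ConvexOnE (J : Set ℝ) (ψ : ℝ → EReal) : Prop :=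
  Convex ℝ {p : ℝ × ℝ | p.1 ∈ J ∧ ψ p.1 ≤ (p.2 : EReal)}

/-- A function `J → [-∞, ∞]` is concave if its hypograph is convex. -/
def ConcaveOnE (J : Set ℝ) (φ : ℝ → EReal) : Prop :=
  Convex ℝ {p : ℝ × ℝ | p.1 ∈ J ∧ (p.2 : EReal) ≤ φ p.1}

/-- The admissible set of the auxiliary dual problem. As `⊤ + ⊥ = ⊥` in `EReal`, the inequality
`f ≤ φ + ψ` fails for `f ≥ 0` wherever the sum would be of the form `∞ - ∞`. -/
structure DualAdmissible (μ ν : Measure ℝ) (f : ℝ → ℝ≥0∞) (φ ψ : ℝ → EReal) : Prop where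
  memLc : MemLc (domI μ ν) (domJ μ ν) μ ν φ ψ
  concave : ConcaveOnE (domJ μ ν) φ
  convex : ConvexOnE (domJ μ ν) ψ
  superhedge : ∀ x ∈ domJ μ ν, (f x : EReal) ≤ φ x + ψ x

/-- The auxiliary dual value: the infimum of `μ(φ) + ν(ψ)` over the admissible pairs. -/
def auxDual (μ ν : Measure ℝ) (f : ℝ → ℝ≥0∞) : EReal :=
  ⨅ (φ : ℝ → EReal) (ψ : ℝ → EReal) (_ : DualAdmissible μ ν f φ ψ),
    generalizedIntegral (domI μ ν) (domJ μ ν) μ ν φ ψ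

/-- The outer integral of a nonnegative function (its integral if the function is Borel). -/
def outerIntegral (θ : Measure ℝ) (f : ℝ → ℝ≥0∞) : ℝ≥0∞ :=
  ⨅ (g : ℝ → ℝ≥0∞) (_ : Measurable g) (_ : f ≤ g), ∫⁻ x, g x ∂θ

theorem outerIntegral_eq_lintegral (θ : Measure ℝ) {f : ℝ → ℝ≥0∞} (hf : Measurable f) :
    outerIntegral θ f = ∫⁻ x, f x ∂θ :=
  le_antisymm (iInf_le_of_le f (iInf_le_of_le hf (iInf_le_of_le le_rfl le_rfl)))
    (le_iInf fun _ => le_iInf fun _ => le_iInf fun h => lintegral_mono h)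

/-- The auxiliary primal value: the supremum of `θ(f)` over `μ ≤_c θ ≤_c ν`. -/
def auxPrimal (μ ν : Measure ℝ) (f : ℝ → ℝ≥0∞) : ℝ≥0∞ :=
  ⨆ (θ : Measure ℝ) (_ : ConvexOrder μ θ) (_ : ConvexOrder θ ν), outerIntegral θ f

end ConvexOrderDuality

end

open MeasureTheory Set Filter Topology
open scoped ENNReal NNReal CompactlySupported

noncomputable section

namespace ConvexOrderDuality

/-! Weak duality. Let `θ` lie between `μ` and `ν`. Strassen's theorem
(`ConvexOrder.exists_martingaleCoupling`) gives martingale steps x → y from `μ` to `θ` and y → z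
from `θ` to `ν`. Put B = ψ + χ for a concave moderator χ. Tangent inequalities for φ, ψ and χ at the
starting point of each step yield, up to martingale increments, f(y) - B(y) ≤ (φ - χ)(x) + gap(x, y)
and B(y) ≤ B(z) + gap(y, z), where the gap bounds the distance from χ to its tangent. By Taylor's
formula with the measure -χ'', the mean gap of a step is at most half the integral of the difference
of the potentials plus a jump term. These add up over both steps to at most (μ - ν)(χ)
(`Irreducible.lintegral_gap_add_le`). Summing gives θ(f) ≤ μ(φ - χ) + ν(ψ + χ) + (μ - ν)(χ). The
slopes may be unbounded, so the increments need not be integrable. `integral_le_of_le_add_increment`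
removes them by truncation, given an integrable lower bound.

Strong duality. Concave φ and convex ψ of linear growth on the whole line already suffice, with
price μ(φ) + ν(ψ). The least price of a pair with φ + ψ ≥ g is sublinear in g, so Hahn–Banach gives
a linear functional below it that agrees with it at f. The functional is positive and gives little
weight to tails, so by Riesz it is a measure `θ` on continuous functions. Its price bounds say
exactly that `θ` lies between `μ` and `ν` in convex order. Continuous majorants decreasing to an
upper semicontinuous f show that θ(f) is at least the price of f. Each such pair is admissible with
moderator 0 (`Irreducible.auxDual_le`), so the dual value is at most θ(f).

The abstract form of this argument, `HedgingCone.exists_measure`, is used twice: for the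
intermediate measure and, on the plane, for Strassen's theorem. -/

/-! ### Superhedging duality for abstract cones: Hahn–Banach and Riesz. -/

/-- A sublinear functional dominates a linear functional that agrees with it at a given point. -/
theorem exists_linearMap_le_sublinear {E : Type*} [AddCommGroup E] [Module ℝ E] (N : E → ℝ)
    (hom : ∀ c : ℝ, 0 < c → ∀ x, N (c • x) = c * N x) (add : ∀ x y, N (x + y) ≤ N x + N y)
    (x₀ : E) : ∃ L : E →ₗ[ℝ] ℝ, (∀ x, L x ≤ N x) ∧ L x₀ = N x₀ := by
  have N0 : N 0 = 0 := by
    have := hom 2 (by norm_num) 0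
    rw [smul_zero] at this
    linarith
  by_cases hx : x₀ = 0
  · obtain ⟨L, -, hL⟩ := exists_extension_of_le_sublinear (⊥ : E →ₗ.[ℝ] ℝ) N hom add (by
      rintro ⟨x, hx⟩
      have h0 : x = 0 := (Submodule.mem_bot ℝ).1 hx
      subst h0
      have : (⟨0, hx⟩ : (⊥ : E →ₗ.[ℝ] ℝ).domain) = 0 := rfl
      rw [this, LinearPMap.map_zero]
      simp [N0])
    exact ⟨L, hL, by rw [hx, map_zero, N0]⟩
  · obtain ⟨L, hL0, hL⟩ := exists_extension_of_le_sublinear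
      (LinearPMap.mkSpanSingleton x₀ (N x₀) hx) N hom add (by
      rintro ⟨x, hx'⟩
      obtain ⟨c, rfl⟩ := Submodule.mem_span_singleton.1 hx'
      rw [LinearPMap.mkSpanSingleton'_apply]
      change c * N x₀ ≤ N (c • x₀)
      rcases lt_trichotomy c 0 with hc | hc | hc
      · have h1 := hom (-c) (by linarith) x₀
        have h2 := add (c • x₀) ((-c) • x₀)
        rw [← add_smul, add_neg_cancel, zero_smul, N0, h1] at h2
        linarith
      · simp [hc, N0]
      · simp [hom c hc])
    refine ⟨L, hL, ?_⟩
    have := hL0 ⟨x₀, Submodule.mem_span_singleton_self x₀⟩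
    rwa [LinearPMap.mkSpanSingleton_apply] at this

/-- A bounded upper semicontinuous function is a pointwise limit of uniformly bounded continuous
majorants. -/
theorem exists_continuous_approx_of_upperSemicontinuous {X : Type*} [PseudoMetricSpace X]
    {g : X → ℝ} (hg : UpperSemicontinuous g) {C : ℝ} (hC : ∀ x, |g x| ≤ C) :
    ∃ G : ℕ → X → ℝ, (∀ n, Continuous (G n)) ∧ (∀ n x, g x ≤ G n x) ∧ (∀ n x, |G n x| ≤ C) ∧
      ∀ x, Tendsto (fun n => G n x) atTop (𝓝 (g x)) := by
  have hb : ∀ (n : ℕ) (x : X), BddAbove (range fun y => g y - n * dist x y) := by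
    rintro n x
    refine ⟨C, ?_⟩
    rintro _ ⟨y, rfl⟩
    have : 0 ≤ n * dist x y := by positivity
    have := (abs_le.1 (hC y)).2
    dsimp only
    linarith
  have hle : ∀ (n : ℕ) x, g x ≤ ⨆ y, (g y - n * dist x y) := fun n x => by
    simpa using le_ciSup (hb n x) x
  have hub : ∀ (n : ℕ) x, (⨆ y, (g y - n * dist x y)) ≤ C := fun n x => by
    have : Nonempty X := ⟨x⟩
    refine ciSup_le fun y => ?_
    have : 0 ≤ n * dist x y := by positivity
    have := (abs_le.1 (hC y)).2
    linarith
  -- Sup-convolution with n times the distance: `n`-Lipschitz and at least `g`.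
  refine ⟨fun n x => ⨆ y, (g y - n * dist x y), fun n => ?_, hle, fun n x => ?_, fun x => ?_⟩
  · refine (LipschitzWith.of_le_add_mul (n : ℝ≥0) fun x x' => ?_).continuous
    have : Nonempty X := ⟨x⟩
    refine ciSup_le fun y => ?_
    have h1 := le_ciSup (hb n x') y
    have h2 : (n : ℝ) * dist x' y ≤ n * (dist x x' + dist x y) := by
      gcongr
      rw [dist_comm x x']
      exact dist_triangle _ _ _
    simp only [NNReal.coe_natCast]
    linarith
  · exact abs_le.2 ⟨(abs_le.1 (hC x)).1.trans (hle n x), hub n x⟩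
  · have : Nonempty X := ⟨x⟩
    refine tendsto_order.2 ⟨fun a ha => Eventually.of_forall fun n => ha.trans_le (hle n x),
      fun a ha => ?_⟩
    obtain ⟨b, hb1, hb2⟩ := exists_between ha
    obtain ⟨δ, hδ, hδ'⟩ := Metric.eventually_nhds_iff.1 (hg x b hb1)
    -- Past this index a point at distance at least `δ` contributes at most C - 2C = -C ≤ g x, so
    -- only nearby points matter.
    obtain ⟨n₀, hn₀⟩ := exists_nat_ge (2 * C / δ)
    filter_upwards [eventually_ge_atTop n₀] with n hn
    refine lt_of_le_of_lt (ciSup_le fun y => ?_) hb2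
    rcases lt_or_ge (dist y x) δ with h | h
    · have : 0 ≤ n * dist x y := by positivity
      have := hδ' h
      linarith
    · have h1 : 2 * C / δ ≤ n := hn₀.trans (by exact_mod_cast hn)
      rw [div_le_iff₀ hδ] at h1
      have h2 : (n : ℝ) * δ ≤ n * dist x y := by
        rw [dist_comm] at h
        gcongr
      have := (abs_le.1 (hC y)).2
      have := (abs_le.1 (hC x)).1
      linarith

/-- The functions that are dominated by a multiple of `w`. -/
def growthSpace {X : Type*} (w : X → ℝ) : Submodule ℝ (X → ℝ) where
  carrier := {g | ∃ C : ℝ, ∀ x, |g x| ≤ C * w x}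
  zero_mem' := ⟨0, by simp⟩
  add_mem' := by
    rintro f g ⟨C, hC⟩ ⟨D, hD⟩
    refine ⟨C + D, fun x => ?_⟩
    rw [Pi.add_apply, add_mul]
    exact (abs_add_le _ _).trans (add_le_add (hC x) (hD x))
  smul_mem' := by
    rintro c f ⟨C, hC⟩
    refine ⟨|c| * C, fun x => ?_⟩
    rw [Pi.smul_apply, smul_eq_mul, abs_mul, mul_assoc]
    exact mul_le_mul_of_nonneg_left (hC x) (abs_nonneg c)

/-- A cone of pairs (payoff, cost) without arbitrage, in which the tails of `w` are cheap. -/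
structure HedgingCone {X : Type*} (w : X → ℝ) (K : Set ((X → ℝ) × ℝ)) : Prop where
  add : ∀ p ∈ K, ∀ q ∈ K, p + q ∈ K
  smul : ∀ c : ℝ, 0 < c → ∀ p ∈ K, c • p ∈ K
  nonneg : ∀ p ∈ K, (∀ x, 0 ≤ p.1 x) → 0 ≤ p.2
  growth : ∀ p ∈ K, p.1 ∈ growthSpace w
  dominating : ∃ p ∈ K, ∀ x, w x ≤ p.1 x
  tail : ∀ ε : ℝ, 0 < ε → ∃ n : ℕ, ∃ p ∈ K, (∀ x, 0 ≤ p.1 x ∧ w x - n ≤ p.1 x) ∧ p.2 ≤ ε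

theorem compactlySupported_mem_growthSpace {X : Type*} [TopologicalSpace X] {w : X → ℝ}
    (hw : ∀ x, 1 ≤ w x) {g : X → ℝ} (hg : Continuous g) (hc : HasCompactSupport g) :
    g ∈ growthSpace w := by
  obtain ⟨C, hC⟩ := hc.exists_bound_of_continuous hg
  refine ⟨C, fun x => (hC x).trans ?_⟩
  have h0 : 0 ≤ C := (norm_nonneg _).trans (hC x)
  nlinarith [hw x]

theorem tail_mem_growthSpace {X : Type*} {w : X → ℝ} (hw : ∀ x, 1 ≤ w x) (n : ℕ) :
    (fun x => max (w x - n) 0) ∈ growthSpace w := by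
  refine ⟨1, fun x => ?_⟩
  have : (0 : ℝ) ≤ n := n.cast_nonneg
  rw [abs_of_nonneg (le_max_right _ _), one_mul]
  exact max_le (by linarith) (by linarith [hw x])

/-- Riesz representation of a positive linear functional on functions of restricted growth under
which the tails are negligible. -/
theorem exists_measure_of_positive {X : Type*} [TopologicalSpace X] [T2Space X]
    [LocallyCompactSpace X] [MeasurableSpace X] [BorelSpace X] {w : X → ℝ} (hwc : Continuous w)
    (hw : ∀ x, 1 ≤ w x) (hcomp : ∀ n : ℕ, IsCompact {x | w x ≤ n}) (L : growthSpace w →ₗ[ℝ] ℝ)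
    (hpos : ∀ v : growthSpace w, (∀ x, 0 ≤ v.1 x) → 0 ≤ L v)
    (htail : ∀ ε : ℝ, 0 < ε → ∃ n : ℕ, L ⟨_, tail_mem_growthSpace hw n⟩ ≤ ε) :
    ∃ π : Measure X, IsFiniteMeasure π ∧ Integrable w π ∧
      ∀ v : growthSpace w, Continuous v.1 → ∫ x, v.1 x ∂π = L v := by
  have hmono : ∀ v v' : growthSpace w, (∀ x, v.1 x ≤ v'.1 x) → L v ≤ L v' := by
    intro v v' h
    have := hpos (v' - v) fun x => sub_nonneg.2 (h x)
    rw [map_sub] at this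
    linarith
  let ι : C_c(X, ℝ) →ₗ[ℝ] growthSpace w :=
    { toFun := fun g => ⟨g, compactlySupported_mem_growthSpace hw g.continuous g.hasCompactSupport⟩
      map_add' := fun _ _ => rfl
      map_smul' := fun _ _ => rfl }
  let Λ : C_c(X, ℝ) →ₚ[ℝ] ℝ := PositiveLinearMap.mk₀ (L.comp ι) fun g hg => hpos _ hg
  set π := RealRMK.rieszMeasure Λ with hπ
  have hΛ : ∀ g : C_c(X, ℝ), ∫ x, g x ∂π = L (ι g) := fun g => RealRMK.integral_rieszMeasure Λ g
  -- Continuous cutoffs, equal to 1 where w ≤ n and to 0 where w ≥ n + 1.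
  set κ : ℕ → X → ℝ := fun n x => max 0 (min 1 (n + 1 - w x)) with hκ
  have hκc : ∀ n, Continuous (κ n) := fun n => by fun_prop
  have hκ0 : ∀ n x, 0 ≤ κ n x := fun n x => le_max_left _ _
  have hκ1 : ∀ n x, κ n x ≤ 1 := fun n x => max_le zero_le_one (min_le_left _ _)
  have hκeq : ∀ (n : ℕ) x, w x ≤ n → κ n x = 1 := fun n x h => by
    rw [hκ]
    dsimp only
    rw [min_eq_left (by linarith), max_eq_right zero_le_one]
  have hκs : ∀ n, HasCompactSupport (κ n) := fun n => by
    refine HasCompactSupport.of_support_subset_isCompact (hcomp (n + 1)) fun x hx => ?_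
    by_contra h
    simp only [mem_ofPred_eq, not_le, Nat.cast_add, Nat.cast_one] at h
    refine hx ?_
    rw [hκ]
    exact max_eq_left ((min_le_right _ _).trans (by linarith))
  have hvs : ∀ (v : X → ℝ) n, HasCompactSupport fun x => v x * κ n x := fun v n => (hκs n).mul_left
  have hmem : ∀ (v : growthSpace w) (n : ℕ), (fun x => v.1 x * κ n x) ∈ growthSpace w := by
    rintro ⟨v, C, hC⟩ n
    refine ⟨C, fun x => ?_⟩
    rw [abs_mul, abs_of_nonneg (hκ0 n x)]
    exact (mul_le_of_le_one_right (abs_nonneg _) (hκ1 n x)).trans (hC x)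
  have hlim : ∀ v : growthSpace w, Tendsto (fun n => L ⟨_, hmem v n⟩) atTop (𝓝 (L v)) := by
    intro v
    obtain ⟨C, hC⟩ := v.2
    have hCn : ∀ x, 0 ≤ C * w x := fun x => (abs_nonneg _).trans (hC x)
    refine Metric.tendsto_atTop.2 fun ε hε => ?_
    obtain ⟨m, hm⟩ := htail (ε / (2 * (|C| + 1) + 1)) (by positivity)
    -- Where w > n ≥ 2m one has w ≤ 2(w - m), so the tail at level `m` dominates the truncation
    -- error.
    refine ⟨2 * m, fun n hn => ?_⟩
    have hn' : (2 : ℝ) * m ≤ n := by exact_mod_cast hn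
    have hm0 : (0 : ℝ) ≤ m := m.cast_nonneg
    have key : ∀ x, |v.1 x * κ n x - v.1 x| ≤ 2 * (|C| + 1) * max (w x - m) 0 := by
      intro x
      rcases le_or_gt (w x) n with h | h
      · rw [hκeq n x h, mul_one, sub_self, abs_zero]
        positivity
      · have h1 : |v.1 x * κ n x - v.1 x| ≤ |v.1 x| := by
          rw [show v.1 x * κ n x - v.1 x = -(v.1 x * (1 - κ n x)) by ring, abs_neg, abs_mul]
          refine mul_le_of_le_one_right (abs_nonneg _) ?_
          rw [abs_of_nonneg (by linarith [hκ1 n x])]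
          linarith [hκ0 n x]
        have h2 : |v.1 x| ≤ (|C| + 1) * w x := (hC x).trans
          (mul_le_mul_of_nonneg_right ((le_abs_self C).trans (by linarith)) (by linarith [hw x]))
        have h3 : w x ≤ 2 * max (w x - m) 0 := by
          have := le_max_left (w x - m) 0
          linarith
        calc _ ≤ (|C| + 1) * w x := h1.trans h2
          _ ≤ (|C| + 1) * (2 * max (w x - m) 0) := by gcongr
          _ = _ := by ring
    set t : growthSpace w := ⟨_, tail_mem_growthSpace hw m⟩ with ht
    have e1 : L (⟨_, hmem v n⟩ - v) ≤ L ((2 * (|C| + 1)) • t) :=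
      hmono _ _ fun x => (abs_le.1 (key x)).2
    have e2 : L (-((2 * (|C| + 1)) • t)) ≤ L (⟨_, hmem v n⟩ - v) :=
      hmono _ _ fun x => (abs_le.1 (key x)).1
    rw [map_neg] at e2
    rw [map_sub] at e1 e2
    rw [map_smul, smul_eq_mul] at e1 e2
    rw [Real.dist_eq]
    refine (abs_le.2 ⟨e2, e1⟩).trans_lt ?_
    have : 2 * (|C| + 1) * L t ≤ 2 * (|C| + 1) * (ε / (2 * (|C| + 1) + 1)) := by gcongr
    refine this.trans_lt ?_
    rw [mul_div_assoc', div_lt_iff₀ (by positivity)]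
    nlinarith
  have hint : ∀ (v : growthSpace w), Continuous v.1 → ∀ n,
      ∫ x, v.1 x * κ n x ∂π = L ⟨_, hmem v n⟩ := fun v hv n =>
    hΛ ⟨⟨_, hv.mul (hκc n)⟩, hvs _ n⟩
  let W : growthSpace w := ⟨w, 1, fun x => by rw [one_mul, abs_of_nonneg (by linarith [hw x])]⟩
  have hκlim : ∀ (a : ℝ) x, ∀ᶠ n in atTop, a * κ n x = a := by
    intro a x
    obtain ⟨n₀, hn₀⟩ := exists_nat_ge (w x)
    filter_upwards [eventually_ge_atTop n₀] with n hn
    rw [hκeq n x (hn₀.trans (by exact_mod_cast hn)), mul_one]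
  -- Fatou along the cutoffs: each truncated integral is at most `L W`.
  have hwint : Integrable w π := by
    refine ⟨hwc.aestronglyMeasurable, ?_⟩
    rw [hasFiniteIntegral_iff_ofReal (ae_of_all _ fun x => zero_le_one.trans (hw x))]
    refine lt_of_le_of_lt ?_ (ENNReal.ofReal_lt_top (r := L W))
    calc ∫⁻ x, ENNReal.ofReal (w x) ∂π
        = ∫⁻ x, liminf (fun n => ENNReal.ofReal (w x * κ n x)) atTop ∂π := by
          congr 1 with x
          refine (Tendsto.liminf_eq (tendsto_const_nhds.congr' ?_)).symm
          filter_upwards [hκlim (w x) x] with n hn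
          rw [hn]
      _ ≤ liminf (fun n => ∫⁻ x, ENNReal.ofReal (w x * κ n x) ∂π) atTop :=
          lintegral_liminf_le fun n => by
            have := hκc n
            fun_prop
      _ ≤ ENNReal.ofReal (L W) := by
          refine liminf_le_of_le (by isBoundedDefault) fun b hb => ?_
          obtain ⟨n, hn⟩ := hb.exists
          refine hn.trans ?_
          have hi : Integrable (fun x => w x * κ n x) π :=
            (hwc.mul (hκc n)).integrable_of_hasCompactSupport (hvs w n)
          rw [← ofReal_integral_eq_lintegral_ofReal hi
            (ae_of_all _ fun x => mul_nonneg (zero_le_one.trans (hw x)) (hκ0 n x))]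
          refine ENNReal.ofReal_le_ofReal ((hint W hwc n).le.trans (hmono _ _ fun x => ?_))
          exact mul_le_of_le_one_right (zero_le_one.trans (hw x)) (hκ1 n x)
  have hfin : IsFiniteMeasure π := by
    have h1 : Integrable (fun _ : X => (1 : ℝ)) π :=
      hwint.mono' aestronglyMeasurable_const (ae_of_all _ fun x => by simpa using hw x)
    exact (integrable_const_iff_isFiniteMeasure one_ne_zero).1 h1
  refine ⟨π, hfin, hwint, fun v hv => ?_⟩
  obtain ⟨C, hC⟩ := v.2
  refine tendsto_nhds_unique ?_ (hlim v)
  simp only [← hint v hv]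
  refine tendsto_integral_of_dominated_convergence (fun x => C * w x)
    (fun n => (hv.mul (hκc n)).aestronglyMeasurable) (hwint.const_mul C)
    (fun n => ae_of_all _ fun x => ?_) (ae_of_all _ fun x => ?_)
  · rw [Real.norm_eq_abs, abs_mul, abs_of_nonneg (hκ0 n x)]
    exact (mul_le_of_le_one_right (abs_nonneg _) (hκ1 n x)).trans (hC x)
  · refine tendsto_const_nhds.congr' ?_
    filter_upwards [hκlim (v.1 x) x] with n hn
    rw [hn]

namespace HedgingCone

variable {X : Type*} {w : X → ℝ} {K : Set ((X → ℝ) × ℝ)}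

/-- Hahn–Banach: the superhedging cost of `g` is attained by a linear pricing functional. -/
theorem exists_pricing (hK : HedgingCone w K) (hw : ∀ x, 1 ≤ w x) (g : growthSpace w) :
    ∃ L : growthSpace w →ₗ[ℝ] ℝ, (∀ p ∈ K, ∀ v : growthSpace w, (∀ x, v.1 x ≤ p.1 x) → L v ≤ p.2) ∧
      (∀ v : growthSpace w, (∀ x, 0 ≤ v.1 x) → 0 ≤ L v) ∧
      ∀ c : ℝ, (∀ p ∈ K, (∀ x, g.1 x ≤ p.1 x) → c ≤ p.2) → c ≤ L g := by
  -- `S v` collects the costs of payoffs above `v`; their infimum `N v` is the superhedging cost.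
  set S : growthSpace w → Set ℝ := fun v => {c | ∃ p ∈ K, (∀ x, v.1 x ≤ p.1 x) ∧ p.2 = c} with hS
  set N : growthSpace w → ℝ := fun v => sInf (S v) with hN
  obtain ⟨p₀, hp₀, hp₀w⟩ := hK.dominating
  have hne : ∀ v, (S v).Nonempty := by
    rintro ⟨v, C, hC⟩
    refine ⟨_, (|C| + 1) • p₀, hK.smul _ (by positivity) _ hp₀, fun x => ?_, rfl⟩
    have h1 := (abs_le.1 (hC x)).2
    have h2 : C * w x ≤ (|C| + 1) * w x :=
      mul_le_mul_of_nonneg_right ((le_abs_self C).trans (by linarith)) (by linarith [hw x])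
    have h3 : (|C| + 1) * w x ≤ (|C| + 1) * p₀.1 x :=
      mul_le_mul_of_nonneg_left (hp₀w x) (by positivity)
    exact h1.trans (h2.trans h3)
  -- Added to a fixed hedge of `-v`, any hedge of `v` is a nonnegative payoff. Absence of arbitrage
  -- bounds its cost from below.
  have hbd : ∀ v, BddBelow (S v) := by
    intro v
    obtain ⟨c', p', hp', hv', rfl⟩ := hne (-v)
    refine ⟨-p'.2, ?_⟩
    rintro _ ⟨p, hp, hv, rfl⟩
    have := hK.nonneg _ (hK.add _ hp _ hp') fun x => by
      have h1 := hv x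
      have h2 := hv' x
      simp only [Submodule.coe_neg, Pi.neg_apply] at h2
      simp only [Prod.fst_add, Pi.add_apply]
      linarith
    simp only [Prod.snd_add] at this
    linarith
  have hNle : ∀ p ∈ K, ∀ v : growthSpace w, (∀ x, v.1 x ≤ p.1 x) → N v ≤ p.2 :=
    fun p hp v hv => csInf_le (hbd v) ⟨p, hp, hv, rfl⟩
  have hmul : ∀ c : ℝ, 0 < c → ∀ v, N (c • v) ≤ c * N v := by
    intro c hc v
    rw [← div_le_iff₀' hc]
    refine le_csInf (hne v) ?_
    rintro _ ⟨p, hp, hv, rfl⟩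
    rw [div_le_iff₀' hc]
    exact hNle _ (hK.smul c hc p hp) _ fun x => mul_le_mul_of_nonneg_left (hv x) hc.le
  have hadd : ∀ v v', N (v + v') ≤ N v + N v' := by
    intro v v'
    rw [← sub_le_iff_le_add']
    refine le_csInf (hne v') ?_
    rintro _ ⟨p', hp', hv', rfl⟩
    rw [sub_le_comm]
    refine le_csInf (hne v) ?_
    rintro _ ⟨p, hp, hv, rfl⟩
    rw [sub_le_iff_le_add]
    exact hNle _ (hK.add _ hp _ hp') _ fun x => add_le_add (hv x) (hv' x)
  obtain ⟨L, hL, hLg⟩ := exists_linearMap_le_sublinear N (fun c hc v => by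
    refine le_antisymm (hmul c hc v) ?_
    have := hmul c⁻¹ (inv_pos.2 hc) (c • v)
    rw [smul_smul, inv_mul_cancel₀ hc.ne', one_smul] at this
    rwa [← le_inv_mul_iff₀ hc]) hadd g
  refine ⟨L, fun p hp v hv => (hL v).trans (hNle p hp v hv), fun v hv => ?_, fun c hc => ?_⟩
  -- Tail payoffs are nonnegative and arbitrarily cheap, so they superhedge `-v` at no cost in the
  -- limit.
  · have h1 : N (-v) ≤ 0 := by
      refine le_of_forall_pos_le_add fun ε hε => ?_
      obtain ⟨n, p, hp, hpos, hpε⟩ := hK.tail ε hε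
      rw [zero_add]
      refine (hNle p hp _ fun x => ?_).trans hpε
      have := hv x
      have := (hpos x).1
      simp only [Submodule.coe_neg, Pi.neg_apply]
      linarith
    have := (hL (-v)).trans h1
    rw [map_neg] at this
    linarith
  · rw [hLg]
    refine le_csInf (hne g) ?_
    rintro _ ⟨p, hp, hv, rfl⟩
    exact hc p hp hv

/-- Superhedging duality: some measure that prices every continuous payoff of the cone at most at
its cost assigns to `g` at least its superhedging cost. -/
theorem exists_measure [MetricSpace X] [LocallyCompactSpace X] [MeasurableSpace X] [BorelSpace X]
    (hK : HedgingCone w K) (hwc : Continuous w) (hw : ∀ x, 1 ≤ w x)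
    (hcomp : ∀ n : ℕ, IsCompact {x | w x ≤ n}) {g : X → ℝ} (hg : UpperSemicontinuous g) {C : ℝ}
    (hC : ∀ x, |g x| ≤ C) :
    ∃ π : Measure X, IsFiniteMeasure π ∧ Integrable w π ∧
      (∀ p ∈ K, Continuous p.1 → ∫ x, p.1 x ∂π ≤ p.2) ∧
      ∀ c : ℝ, (∀ p ∈ K, (∀ x, g x ≤ p.1 x) → c ≤ p.2) → c ≤ ∫ x, g x ∂π := by
  have hbdd : ∀ h : X → ℝ, (∀ x, |h x| ≤ C) → h ∈ growthSpace w := fun h hh =>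
    ⟨C, fun x => (hh x).trans (by nlinarith [hw x, (abs_nonneg _).trans (hh x)])⟩
  obtain ⟨L, hLK, hLpos, hLg⟩ := hK.exists_pricing hw ⟨g, hbdd g hC⟩
  obtain ⟨π, hfin, hwint, hπ⟩ := exists_measure_of_positive hwc hw hcomp L hLpos fun ε hε => by
    obtain ⟨n, p, hp, hp1, hp2⟩ := hK.tail ε hε
    exact ⟨n, (hLK p hp _ fun x => max_le (hp1 x).2 (hp1 x).1).trans hp2⟩
  refine ⟨π, hfin, hwint, fun p hp hpc => ?_, fun c hc => (hLg c hc).trans ?_⟩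
  · rw [hπ ⟨p.1, hK.growth p hp⟩ hpc]
    exact hLK p hp _ fun x => le_rfl
  -- `π` represents `L` only on continuous functions, so `g` is reached through continuous majorants
  -- and positivity of `L`.
  · obtain ⟨G, hGc, hgG, hGC, hGlim⟩ := exists_continuous_approx_of_upperSemicontinuous hg hC
    refine ge_of_tendsto' (tendsto_integral_of_dominated_convergence (fun _ => C)
      (fun n => (hGc n).aestronglyMeasurable) (integrable_const C)
      (fun n => ae_of_all _ (hGC n)) (ae_of_all _ hGlim)) fun n => ?_
    rw [hπ ⟨G n, hbdd _ (hGC n)⟩ (hGc n)]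
    have := hLpos (⟨G n, hbdd _ (hGC n)⟩ - ⟨g, hbdd g hC⟩) fun x => sub_nonneg.2 (hgG n x)
    rw [map_sub] at this
    linarith

end HedgingCone

/-! ### The convex order and functions of linear growth. -/

theorem extIntegral_of_integrable {μ : Measure ℝ} {g : ℝ → ℝ} (hg : Integrable g μ) :
    extIntegral μ g = ((∫ x, g x ∂μ : ℝ) : EReal) := by
  have h1 : ∫⁻ x, ENNReal.ofReal (g x) ∂μ ≠ ⊤ :=
    ((lintegral_ofReal_le_lintegral_enorm g).trans_lt hg.2).ne
  have h2 : ∫⁻ x, ENNReal.ofReal (-g x) ∂μ ≠ ⊤ :=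
    ((lintegral_ofReal_le_lintegral_enorm (fun x => -g x)).trans_lt hg.neg.2).ne
  rw [integral_eq_lintegral_pos_part_sub_lintegral_neg_part hg, EReal.coe_sub,
    EReal.coe_ennreal_toReal h1, EReal.coe_ennreal_toReal h2, extIntegral]

/-- The weight that controls functions of linear growth on `ℝ`. -/
def linearWeight (x : ℝ) : ℝ := 1 + |x|

theorem one_le_linearWeight (x : ℝ) : 1 ≤ linearWeight x := by
  have := abs_nonneg x
  unfold linearWeight
  linarith

theorem linearWeight_pos (x : ℝ) : 0 < linearWeight x := one_pos.trans_le (one_le_linearWeight x)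

theorem continuous_linearWeight : Continuous linearWeight := by
  unfold linearWeight
  fun_prop

theorem isCompact_linearWeight_le (n : ℕ) : IsCompact {x | linearWeight x ≤ n} := by
  refine (isCompact_Icc (a := -(n : ℝ)) (b := n)).of_isClosed_subset
    (isClosed_le continuous_linearWeight continuous_const) fun x hx => ?_
  have h : 1 + |x| ≤ n := hx
  exact abs_le.1 (by linarith)

theorem integrable_linearWeight {μ : Measure ℝ} [IsFiniteMeasure μ]
    (h : Integrable (fun x : ℝ => x) μ) : Integrable linearWeight μ :=
  (integrable_const 1).add h.abs

theorem integrable_of_mem_growthSpace {X : Type*} [TopologicalSpace X] [MeasurableSpace X]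
    [OpensMeasurableSpace X] {w : X → ℝ} {μ : Measure X} (hw : Integrable w μ) {g : X → ℝ}
    (hg : g ∈ growthSpace w) (hc : Continuous g) : Integrable g μ := by
  obtain ⟨C, hC⟩ := hg
  exact (hw.const_mul C).mono' hc.measurable.aestronglyMeasurable (ae_of_all _ hC)

theorem _root_.ConvexOn.continuous_of_univ {φ : ℝ → ℝ} (h : ConvexOn ℝ univ φ) : Continuous φ :=
  continuousOn_univ.1 (h.continuousOn isOpen_univ)

theorem _root_.ConcaveOn.continuous_of_univ {φ : ℝ → ℝ} (h : ConcaveOn ℝ univ φ) : Continuous φ :=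
  continuousOn_univ.1 (h.continuousOn isOpen_univ)

theorem affine_mem_growthSpace (a b : ℝ) : (fun x => a * x + b) ∈ growthSpace linearWeight := by
  refine ⟨|a| + |b|, fun x => ?_⟩
  have h1 : |a * x + b| ≤ |a| * |x| + |b| := (abs_add_le _ _).trans (by rw [abs_mul])
  unfold linearWeight
  nlinarith [abs_nonneg a, abs_nonneg b, abs_nonneg x, mul_nonneg (abs_nonneg b) (abs_nonneg x)]

theorem sup_mem_growthSpace {X : Type*} {w : X → ℝ} {f g : X → ℝ}
    (hf : f ∈ growthSpace w) (hg : g ∈ growthSpace w) : f ⊔ g ∈ growthSpace w := by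
  obtain ⟨C, hC⟩ := hf
  obtain ⟨D, hD⟩ := hg
  refine ⟨C + D, fun x => ?_⟩
  have h1 := hC x
  have h2 := hD x
  rw [Pi.sup_apply, add_mul]
  rcases max_choice (f x) (g x) with h | h <;> rw [h] <;>
    linarith [abs_nonneg (f x), abs_nonneg (g x)]

/-- A convex function on `ℝ` is an increasing limit of convex functions of linear growth. -/
theorem exists_monotone_convex_approx {φ : ℝ → ℝ} (hφ : ConvexOn ℝ univ φ) :
    ∃ Φ : ℕ → ℝ → ℝ, (∀ n, ConvexOn ℝ univ (Φ n)) ∧ (∀ n, Φ n ∈ growthSpace linearWeight) ∧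
      (∀ x, Monotone fun n => Φ n x) ∧ (∀ n x, Φ n x ≤ φ x) ∧
      ∀ x, Tendsto (fun n => Φ n x) atTop (𝓝 (φ x)) := by
  obtain ⟨l, c, hle, hsup⟩ :=
    hφ.real_univ_sSup_of_nat_affine_eq hφ.continuous_of_univ.lowerSemicontinuous
  set ℓ : ℕ → ℝ → ℝ := fun n => ⇑(l n) + Function.const ℝ (c n) with hℓ
  have hℓa : ∀ n, ℓ n = fun x => l n 1 * x + c n := fun n => by
    ext x
    have : l n x = x * l n 1 := by
      conv_lhs => rw [← mul_one x, ← smul_eq_mul, map_smul, smul_eq_mul]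
    simp [hℓ, this, mul_comm]
  have hconv : ∀ n, ConvexOn ℝ univ (ℓ n) := fun n => by
    rw [hℓa]
    exact ⟨convex_univ, fun x _ y _ a b _ _ hab => by
      simp only [smul_eq_mul]
      refine le_of_eq ?_
      linear_combination (-c n) * hab⟩
  have hgr : ∀ n, ℓ n ∈ growthSpace linearWeight := fun n => by
    rw [hℓa]
    exact affine_mem_growthSpace _ _
  have hub : ∀ x n, partialSups ℓ n x ≤ φ x := fun x n => (partialSups_le ℓ n φ fun i _ => hle i) x
  refine ⟨fun n => partialSups ℓ n, fun n => ?_, fun n => ?_,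
    fun x m n h => (partialSups ℓ).monotone h x, fun n x => hub x n, fun x => ?_⟩
  · induction n with
    | zero => simpa using hconv 0
    | succ n ih =>
      beta_reduce at ih ⊢
      rw [partialSups_add_one]
      exact ih.sup (hconv _)
  · induction n with
    | zero => simpa using hgr 0
    | succ n ih =>
      beta_reduce at ih ⊢
      rw [partialSups_add_one]
      exact sup_mem_growthSpace ih (hgr _)
  · have hbdd : BddAbove (range fun i => ℓ i x) := ⟨φ x, by rintro _ ⟨i, rfl⟩; exact hle i x⟩
    have hx : φ x = ⨆ i, ℓ i x := by
      conv_lhs => rw [← hsup]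
      rw [iSup_apply]
    refine tendsto_order.2 ⟨fun a ha => ?_, fun a ha => Eventually.of_forall fun n =>
      (hub x n).trans_lt ha⟩
    rw [hx] at ha
    obtain ⟨i, hi⟩ := exists_lt_of_lt_ciSup ha
    filter_upwards [eventually_ge_atTop i] with n hn
    exact hi.trans_le (le_partialSups_of_le ℓ hn x)

/-- It suffices to test the convex order with convex functions of linear growth. -/
theorem ConvexOrder.of_linearGrowth {μ ν : Measure ℝ} [IsFiniteMeasure μ] [IsFiniteMeasure ν]
    (hμ : Integrable (fun x : ℝ => x) μ) (hν : Integrable (fun x : ℝ => x) ν)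
    (h : ∀ φ, ConvexOn ℝ univ φ → φ ∈ growthSpace linearWeight → ∫ x, φ x ∂μ ≤ ∫ x, φ x ∂ν) :
    ConvexOrder μ ν := by
  refine ⟨inferInstance, inferInstance, hμ, hν, fun φ hφ => ?_⟩
  obtain ⟨Φ, hΦc, hΦg, hmono, hΦle, hlim⟩ := exists_monotone_convex_approx hφ
  have hΦi : ∀ {ρ : Measure ℝ} [IsFiniteMeasure ρ], Integrable (fun x : ℝ => x) ρ → ∀ n,
      Integrable (Φ n) ρ := fun hρ n =>
    integrable_of_mem_growthSpace (integrable_linearWeight hρ) (hΦg n) (hΦc n).continuous_of_univ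
  have hneg : ∫⁻ x, ENNReal.ofReal (-φ x) ∂ν ≠ ⊤ := by
    refine ((lintegral_mono fun x => ?_).trans_lt
      ((lintegral_ofReal_le_lintegral_enorm (fun x => -Φ 0 x)).trans_lt (hΦi hν 0).neg.2)).ne
    exact ENNReal.ofReal_le_ofReal (neg_le_neg (hΦle 0 x))
  by_cases htop : ∫⁻ x, ENNReal.ofReal (φ x) ∂ν = ⊤
  · rw [extIntegral, extIntegral, htop, EReal.coe_ennreal_top, ← EReal.coe_ennreal_toReal hneg,
      EReal.top_sub_coe]
    exact le_top
  have hφm : Continuous φ := hφ.continuous_of_univ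
  have hφν : Integrable φ ν := by
    refine ⟨hφm.aestronglyMeasurable, ?_⟩
    rw [hasFiniteIntegral_iff_norm]
    calc ∫⁻ x, ENNReal.ofReal ‖φ x‖ ∂ν
        ≤ ∫⁻ x, (ENNReal.ofReal (φ x) + ENNReal.ofReal (-φ x)) ∂ν := by
          refine lintegral_mono fun x => ?_
          rcases le_total 0 (φ x) with h0 | h0
          · rw [Real.norm_of_nonneg h0]
            exact le_self_add
          · rw [Real.norm_of_nonpos h0]
            exact le_add_self
      _ < ⊤ := by
          rw [lintegral_add_left (by fun_prop)]
          exact ENNReal.add_lt_top.2 ⟨lt_top_iff_ne_top.2 htop, lt_top_iff_ne_top.2 hneg⟩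
  have hle : ∀ n, ∫ x, Φ n x ∂μ ≤ ∫ x, φ x ∂ν := fun n =>
    (h _ (hΦc n) (hΦg n)).trans (integral_mono (hΦi hν n) hφν (hΦle n))
  -- Subtracting `Φ 0` makes the increasing approximants nonnegative. Fatou then carries
  -- integrability of φ from `ν` to `μ`.
  have hφ0 : Integrable (fun x => φ x - Φ 0 x) μ := by
    refine ⟨(hφm.sub (hΦc 0).continuous_of_univ).aestronglyMeasurable, ?_⟩
    rw [hasFiniteIntegral_iff_ofReal (ae_of_all _ fun x => sub_nonneg.2 (hΦle 0 x))]
    refine lt_of_le_of_lt ?_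
      (ENNReal.ofReal_lt_top (r := ∫ x, φ x ∂ν - ∫ x, Φ 0 x ∂μ))
    calc ∫⁻ x, ENNReal.ofReal (φ x - Φ 0 x) ∂μ
        = ∫⁻ x, liminf (fun n => ENNReal.ofReal (Φ n x - Φ 0 x)) atTop ∂μ := by
          congr 1 with x
          refine (Tendsto.liminf_eq ?_).symm
          exact (ENNReal.continuous_ofReal.tendsto _).comp ((hlim x).sub_const _)
      _ ≤ liminf (fun n => ∫⁻ x, ENNReal.ofReal (Φ n x - Φ 0 x) ∂μ) atTop :=
          lintegral_liminf_le fun n => by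
            have := (hΦc n).continuous_of_univ
            have := (hΦc 0).continuous_of_univ
            fun_prop
      _ ≤ _ := by
          refine liminf_le_of_le (by isBoundedDefault) fun b hb => ?_
          obtain ⟨n, hn⟩ := hb.exists
          refine hn.trans ?_
          have hi : Integrable (fun x => Φ n x - Φ 0 x) μ := (hΦi hμ n).sub (hΦi hμ 0)
          rw [← ofReal_integral_eq_lintegral_ofReal hi
            (ae_of_all _ fun x => sub_nonneg.2 (hmono x (Nat.zero_le n))),
            integral_sub (hΦi hμ n) (hΦi hμ 0)]
          exact ENNReal.ofReal_le_ofReal (sub_le_sub_right (hle n) _)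
  have hφμ : Integrable φ μ := by
    refine (hφ0.add (hΦi hμ 0)).congr (ae_of_all _ fun x => ?_)
    simp
  rw [extIntegral_of_integrable hφμ, extIntegral_of_integrable hφν, EReal.coe_le_coe_iff]
  exact le_of_tendsto' (integral_tendsto_of_tendsto_of_monotone (hΦi hμ) hφμ
    (ae_of_all _ hmono) (ae_of_all _ hlim)) hle

namespace ConvexOrder

variable {μ ν : Measure ℝ}

theorem integral_le (h : ConvexOrder μ ν) {φ : ℝ → ℝ} (hφ : ConvexOn ℝ univ φ)
    (hg : φ ∈ growthSpace linearWeight) : ∫ x, φ x ∂μ ≤ ∫ x, φ x ∂ν := by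
  have := h.finite_left
  have := h.finite_right
  have := h.le φ hφ
  rwa [extIntegral_of_integrable (integrable_of_mem_growthSpace
      (integrable_linearWeight h.moment_left) hg hφ.continuous_of_univ),
    extIntegral_of_integrable (integrable_of_mem_growthSpace
      (integrable_linearWeight h.moment_right) hg hφ.continuous_of_univ),
    EReal.coe_le_coe_iff] at this

theorem le_integral (h : ConvexOrder μ ν) {φ : ℝ → ℝ} (hφ : ConcaveOn ℝ univ φ)
    (hg : φ ∈ growthSpace linearWeight) : ∫ x, φ x ∂ν ≤ ∫ x, φ x ∂μ := by
  have := h.integral_le hφ.neg ((growthSpace linearWeight).neg_mem hg)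
  simpa only [Pi.neg_apply, integral_neg, neg_le_neg_iff] using this

theorem integral_affine_eq (h : ConvexOrder μ ν) (a b : ℝ) :
    ∫ x, (a * x + b) ∂μ = ∫ x, (a * x + b) ∂ν := by
  refine le_antisymm (h.integral_le ⟨convex_univ, fun x _ y _ s t _ _ hst => ?_⟩
    (affine_mem_growthSpace a b)) (h.le_integral ⟨convex_univ, fun x _ y _ s t _ _ hst => ?_⟩
    (affine_mem_growthSpace a b))
  · simp only [smul_eq_mul]
    refine le_of_eq ?_
    linear_combination (-b) * hst
  · simp only [smul_eq_mul]
    refine le_of_eq ?_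
    linear_combination b * hst

end ConvexOrder

theorem tendsto_integral_tail {X : Type*} [MeasurableSpace X] {μ : Measure X} {w : X → ℝ}
    (hw : Integrable w μ) : Tendsto (fun n : ℕ => ∫ x, max (w x - n) 0 ∂μ) atTop (𝓝 0) := by
  suffices h : Tendsto (fun n : ℕ => ∫ x, max (w x - n) 0 ∂μ) atTop (𝓝 (∫ _, (0 : ℝ) ∂μ)) by
    rwa [integral_zero] at h
  refine tendsto_integral_of_dominated_convergence (fun x => |w x|) (fun n => ?_) hw.abs
    (fun n => ae_of_all _ fun x => ?_) (ae_of_all _ fun x => ?_)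
  · exact (hw.1.sub aestronglyMeasurable_const).sup aestronglyMeasurable_const
  · rw [Real.norm_of_nonneg (le_max_right _ _)]
    have : (0 : ℝ) ≤ n := n.cast_nonneg
    exact max_le (by linarith [le_abs_self (w x)]) (abs_nonneg _)
  · obtain ⟨n₀, hn₀⟩ := exists_nat_ge (w x)
    refine tendsto_const_nhds.congr' ?_
    filter_upwards [eventually_ge_atTop n₀] with n hn
    have : (n₀ : ℝ) ≤ n := by exact_mod_cast hn
    rw [max_eq_right (by linarith)]

theorem convexOn_linearWeight : ConvexOn ℝ univ linearWeight := by
  exact (convexOn_const _ convex_univ).add (convexOn_norm convex_univ)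

theorem convexOn_linearWeight_tail (n : ℕ) :
    ConvexOn ℝ univ (fun x => max (linearWeight x - n) 0) :=
  (convexOn_linearWeight.sub (concaveOn_const _ convex_univ)).sup (convexOn_const _ convex_univ)

/-! ### Strong duality on the line. -/

/-- Payoffs that are the sum of a concave function, bought at its `μ`-price, and a convex function,
bought at its `ν`-price. -/
def concaveConvexCone (μ ν : Measure ℝ) : Set ((ℝ → ℝ) × ℝ) :=
  {p | ∃ φ ψ : ℝ → ℝ, ConcaveOn ℝ univ φ ∧ ConvexOn ℝ univ ψ ∧ φ ∈ growthSpace linearWeight ∧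
    ψ ∈ growthSpace linearWeight ∧ p = (φ + ψ, ∫ x, φ x ∂μ + ∫ x, ψ x ∂ν)}

/-- Absence of arbitrage is the convex order itself: if φ + ψ ≥ 0, then μ(φ) + ν(ψ) ≥ ν(φ) + ν(ψ) ≥
0. The tails of the weight are convex, hence payoffs of the cone at their small `ν`-price. -/
theorem hedgingCone_concaveConvex {μ ν : Measure ℝ} (h : ConvexOrder μ ν) :
    HedgingCone linearWeight (concaveConvexCone μ ν) := by
  have := h.finite_left
  have := h.finite_right
  have hwμ := integrable_linearWeight h.moment_left
  have hwν := integrable_linearWeight h.moment_right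
  have h0 : ConcaveOn ℝ univ (0 : ℝ → ℝ) := concaveOn_const _ convex_univ
  refine ⟨?_, ?_, ?_, ?_, ?_, ?_⟩
  · rintro _ ⟨φ, ψ, hφ, hψ, hφg, hψg, rfl⟩ _ ⟨φ', ψ', hφ', hψ', hφg', hψg', rfl⟩
    refine ⟨φ + φ', ψ + ψ', hφ.add hφ', hψ.add hψ', Submodule.add_mem _ hφg hφg',
      Submodule.add_mem _ hψg hψg', Prod.ext (add_add_add_comm _ _ _ _) ?_⟩
    simp only [Pi.add_apply, Prod.snd_add]
    rw [integral_add (integrable_of_mem_growthSpace hwμ hφg hφ.continuous_of_univ)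
      (integrable_of_mem_growthSpace hwμ hφg' hφ'.continuous_of_univ),
      integral_add (integrable_of_mem_growthSpace hwν hψg hψ.continuous_of_univ)
      (integrable_of_mem_growthSpace hwν hψg' hψ'.continuous_of_univ)]
    ring
  · rintro c hc _ ⟨φ, ψ, hφ, hψ, hφg, hψg, rfl⟩
    refine ⟨c • φ, c • ψ, hφ.smul hc.le, hψ.smul hc.le, Submodule.smul_mem _ c hφg,
      Submodule.smul_mem _ c hψg, Prod.ext (smul_add _ _ _) ?_⟩
    simp only [Pi.smul_apply, smul_eq_mul, Prod.smul_snd, integral_const_mul]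
    ring
  · rintro _ ⟨φ, ψ, hφ, hψ, hφg, hψg, rfl⟩ hpos
    have h1 := h.le_integral hφ hφg
    have h2 : 0 ≤ ∫ x, (φ x + ψ x) ∂ν := integral_nonneg hpos
    rw [integral_add (integrable_of_mem_growthSpace hwν hφg hφ.continuous_of_univ)
      (integrable_of_mem_growthSpace hwν hψg hψ.continuous_of_univ)] at h2
    dsimp only
    linarith
  · rintro _ ⟨φ, ψ, hφ, hψ, hφg, hψg, rfl⟩
    exact Submodule.add_mem _ hφg hψg
  · refine ⟨_, ⟨0, linearWeight, h0, convexOn_linearWeight, Submodule.zero_mem _,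
      ⟨1, fun x => ?_⟩, rfl⟩, fun x => by simp⟩
    rw [abs_of_pos (linearWeight_pos x), one_mul]
  · intro ε hε
    obtain ⟨n, hn⟩ := ((tendsto_integral_tail hwν).eventually (gt_mem_nhds hε)).exists
    refine ⟨n, _, ⟨0, _, h0, convexOn_linearWeight_tail n, Submodule.zero_mem _,
      tail_mem_growthSpace one_le_linearWeight n, rfl⟩, fun x => ?_, ?_⟩
    · simp
    · simpa using hn.le

/-- Strong duality with concave and convex functions of linear growth on `ℝ`. -/
theorem exists_intermediate_measure {μ ν : Measure ℝ} (h : ConvexOrder μ ν) {g : ℝ → ℝ}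
    (hg : UpperSemicontinuous g) {C : ℝ} (hC : ∀ x, |g x| ≤ C) :
    ∃ θ : Measure ℝ, ConvexOrder μ θ ∧ ConvexOrder θ ν ∧
      ∀ c : ℝ, (∀ φ ψ : ℝ → ℝ, ConcaveOn ℝ univ φ → ConvexOn ℝ univ ψ →
        φ ∈ growthSpace linearWeight → ψ ∈ growthSpace linearWeight → (∀ x, g x ≤ φ x + ψ x) →
        c ≤ ∫ x, φ x ∂μ + ∫ x, ψ x ∂ν) → c ≤ ∫ x, g x ∂θ := by
  have := h.finite_left
  have := h.finite_right
  obtain ⟨θ, hfin, hw, hle, hge⟩ := (hedgingCone_concaveConvex h).exists_measure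
    continuous_linearWeight one_le_linearWeight isCompact_linearWeight_le hg hC
  have hθ : Integrable (fun x : ℝ => x) θ := hw.mono' (by fun_prop) (ae_of_all _ fun x => by
    rw [Real.norm_eq_abs, linearWeight]
    linarith)
  have h0 : ConcaveOn ℝ univ (0 : ℝ → ℝ) := concaveOn_const _ convex_univ
  have h0' : ConvexOn ℝ univ (0 : ℝ → ℝ) := convexOn_const _ convex_univ
  -- The payoffs (-φ, 0) and (0, φ) with φ convex give the two halves of the convex order.
  refine ⟨θ, ConvexOrder.of_linearGrowth h.moment_left hθ fun φ hφ hφg => ?_,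
    ConvexOrder.of_linearGrowth hθ h.moment_right fun φ hφ hφg => ?_, fun c hc => hge c ?_⟩
  · have := hle _ ⟨-φ, 0, hφ.neg, h0', Submodule.neg_mem _ hφg, Submodule.zero_mem _, rfl⟩
      (by simpa using hφ.continuous_of_univ.neg)
    simpa [integral_neg] using this
  · have := hle _ ⟨0, φ, h0, hφ, Submodule.zero_mem _, hφg, rfl⟩
      (by simpa using hφ.continuous_of_univ)
    simpa using this
  · rintro _ ⟨φ, ψ, hφ, hψ, hφg, hψg, rfl⟩ hle
    exact hc φ ψ hφ hψ hφg hψg hle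

/-! ### Strassen's theorem by superhedging on the plane. -/

/-- The weight that controls functions of linear growth on `ℝ × ℝ`. -/
def planeWeight (p : ℝ × ℝ) : ℝ := 1 + |p.1| + |p.2|

theorem one_le_planeWeight (p : ℝ × ℝ) : 1 ≤ planeWeight p := by
  have := abs_nonneg p.1
  have := abs_nonneg p.2
  unfold planeWeight
  linarith

theorem continuous_planeWeight : Continuous planeWeight := by
  unfold planeWeight
  fun_prop

theorem isCompact_planeWeight_le (n : ℕ) : IsCompact {p | planeWeight p ≤ n} := by
  refine ((isCompact_Icc (a := -(n : ℝ)) (b := n)).prod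
    (isCompact_Icc (a := -(n : ℝ)) (b := n))).of_isClosed_subset
    (isClosed_le continuous_planeWeight continuous_const) fun p hp => ?_
  have h : 1 + |p.1| + |p.2| ≤ n := hp
  have h1 := abs_nonneg p.1
  have h2 := abs_nonneg p.2
  exact ⟨abs_le.1 (by linarith), abs_le.1 (by linarith)⟩

theorem exists_bound_of_mem_growthSpace {X : Type*} {w : X → ℝ} (hw : ∀ x, 1 ≤ w x) {g : X → ℝ}
    (hg : g ∈ growthSpace w) : ∃ C, 0 ≤ C ∧ ∀ x, |g x| ≤ C * w x := by
  obtain ⟨C, hC⟩ := hg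
  refine ⟨|C|, abs_nonneg C, fun x => (hC x).trans ?_⟩
  exact mul_le_mul_of_nonneg_right (le_abs_self C) (zero_le_one.trans (hw x))

/-- Payoffs `a(x) + b(y) + h(x) (y - x)`, where `a` is bought at its `μ`-price, `b` at its
`θ`-price, and the trading strategy `h` is free. -/
def martingaleCone (μ θ : Measure ℝ) : Set ((ℝ × ℝ → ℝ) × ℝ) :=
  {p | ∃ a b h : ℝ → ℝ, Continuous a ∧ Continuous b ∧ a ∈ growthSpace linearWeight ∧
    b ∈ growthSpace linearWeight ∧ (∃ C, ∀ x, |h x| ≤ C) ∧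
    p = (fun q => a q.1 + b q.2 + h q.1 * (q.2 - q.1), ∫ x, a x ∂μ + ∫ x, b x ∂θ)}

/-- For the absence of arbitrage, suppose a(x) + b(y) + h(x)(y - x) ≥ 0. The supremum c over x of
the affine functions y ↦ -a(x) - h(x)(y - x) is convex and lies between -a and b, so -μ(a) ≤ μ(c) ≤
θ(c) ≤ θ(b). -/
theorem hedgingCone_martingale {μ θ : Measure ℝ} (hμθ : ConvexOrder μ θ) :
    HedgingCone planeWeight (martingaleCone μ θ) := by
  have := hμθ.finite_left
  have := hμθ.finite_right
  have hwμ := integrable_linearWeight hμθ.moment_left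
  have hwθ := integrable_linearWeight hμθ.moment_right
  refine ⟨?_, ?_, ?_, ?_, ?_, ?_⟩
  · rintro _ ⟨a, b, h, ha, hb, hag, hbg, ⟨C, hC⟩, rfl⟩ _ ⟨a', b', h', ha', hb', hag', hbg',
      ⟨C', hC'⟩, rfl⟩
    refine ⟨a + a', b + b', h + h', ha.add ha', hb.add hb', Submodule.add_mem _ hag hag',
      Submodule.add_mem _ hbg hbg', ⟨C + C', fun x => (abs_add_le _ _).trans
        (add_le_add (hC x) (hC' x))⟩, Prod.ext ?_ ?_⟩
    · ext q
      simp only [Prod.fst_add, Pi.add_apply]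
      ring
    · simp only [Pi.add_apply, Prod.snd_add]
      rw [integral_add (integrable_of_mem_growthSpace hwμ hag ha)
        (integrable_of_mem_growthSpace hwμ hag' ha'),
        integral_add (integrable_of_mem_growthSpace hwθ hbg hb)
        (integrable_of_mem_growthSpace hwθ hbg' hb')]
      ring
  · rintro c hc _ ⟨a, b, h, ha, hb, hag, hbg, ⟨C, hC⟩, rfl⟩
    refine ⟨c • a, c • b, c • h, ha.const_smul c, hb.const_smul c, Submodule.smul_mem _ c hag,
      Submodule.smul_mem _ c hbg, ⟨|c| * C, fun x => ?_⟩, Prod.ext ?_ ?_⟩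
    · rw [Pi.smul_apply, smul_eq_mul, abs_mul]
      exact mul_le_mul_of_nonneg_left (hC x) (abs_nonneg c)
    · ext q
      simp only [Prod.smul_fst, Pi.smul_apply, smul_eq_mul]
      ring
    · simp only [Pi.smul_apply, smul_eq_mul, Prod.smul_snd, integral_const_mul]
      ring
  · rintro _ ⟨a, b, h, ha, hb, hag, hbg, -, rfl⟩ hpos
    dsimp only at hpos ⊢
    set c : ℝ → ℝ := fun y => ⨆ x, (-a x - h x * (y - x)) with hc
    have hle : ∀ y x, -a x - h x * (y - x) ≤ b y := fun y x => by
      have := hpos (x, y)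
      dsimp only at this
      linarith
    have hbd : ∀ y, BddAbove (range fun x => -a x - h x * (y - x)) := fun y =>
      ⟨b y, by rintro _ ⟨x, rfl⟩; exact hle y x⟩
    have hcb : ∀ y, c y ≤ b y := fun y => ciSup_le (hle y)
    have hac : ∀ x, -a x ≤ c x := fun x => by simpa using le_ciSup (hbd x) x
    have hconv : ConvexOn ℝ univ c := by
      refine ⟨convex_univ, fun y _ z _ s t hs ht hst => ciSup_le fun x => ?_⟩
      have h1 := mul_le_mul_of_nonneg_left (le_ciSup (hbd y) x) hs
      have h2 := mul_le_mul_of_nonneg_left (le_ciSup (hbd z) x) ht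
      simp only [smul_eq_mul]
      refine le_trans (le_of_eq ?_) (add_le_add h1 h2)
      linear_combination (a x - h x * x) * hst
    have hcg : c ∈ growthSpace linearWeight := by
      obtain ⟨A, hA0, hA⟩ := exists_bound_of_mem_growthSpace one_le_linearWeight hag
      obtain ⟨B, hB0, hB⟩ := exists_bound_of_mem_growthSpace one_le_linearWeight hbg
      refine ⟨A + B, fun x => abs_le.2 ⟨?_, ?_⟩⟩
      · have := (abs_le.1 (hA x)).2
        have := mul_nonneg hB0 (linearWeight_pos x).le
        linarith [hac x]
      · have := (abs_le.1 (hB x)).2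
        have := mul_nonneg hA0 (linearWeight_pos x).le
        linarith [hcb x]
    have hcc := hconv.continuous_of_univ
    have h1 := hμθ.integral_le hconv hcg
    have h2 : ∫ x, c x ∂θ ≤ ∫ x, b x ∂θ := integral_mono
      (integrable_of_mem_growthSpace hwθ hcg hcc) (integrable_of_mem_growthSpace hwθ hbg hb) hcb
    have h3 : ∫ x, -a x ∂μ ≤ ∫ x, c x ∂μ := integral_mono
      (integrable_of_mem_growthSpace hwμ hag ha).neg
      (integrable_of_mem_growthSpace hwμ hcg hcc) hac
    rw [integral_neg] at h3
    linarith
  · rintro _ ⟨a, b, h, ha, hb, hag, hbg, ⟨C, hC⟩, rfl⟩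
    obtain ⟨A, hA0, hA⟩ := exists_bound_of_mem_growthSpace one_le_linearWeight hag
    obtain ⟨B, hB0, hB⟩ := exists_bound_of_mem_growthSpace one_le_linearWeight hbg
    refine ⟨A + B + C, fun q => ?_⟩
    have h0 : 0 ≤ C := (abs_nonneg _).trans (hC 0)
    have e1 : |a q.1| ≤ A * planeWeight q := (hA q.1).trans
      (mul_le_mul_of_nonneg_left (by unfold linearWeight planeWeight; linarith [abs_nonneg q.2]) hA0)
    have e2 : |b q.2| ≤ B * planeWeight q := (hB q.2).trans
      (mul_le_mul_of_nonneg_left (by unfold linearWeight planeWeight; linarith [abs_nonneg q.1]) hB0)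
    have e3 : |h q.1 * (q.2 - q.1)| ≤ C * planeWeight q := by
      rw [abs_mul]
      refine mul_le_mul (hC _) ((abs_sub _ _).trans ?_) (abs_nonneg _) h0
      unfold planeWeight
      linarith
    calc _ ≤ |a q.1| + |b q.2| + |h q.1 * (q.2 - q.1)| := abs_add_three _ _ _
      _ ≤ _ := by linarith
  · refine ⟨_, ⟨linearWeight, linearWeight, 0, continuous_linearWeight, continuous_linearWeight,
      ⟨1, fun x => ?_⟩, ⟨1, fun x => ?_⟩, ⟨0, by simp⟩, rfl⟩, fun q => ?_⟩
    · rw [abs_of_pos (linearWeight_pos x), one_mul]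
    · rw [abs_of_pos (linearWeight_pos x), one_mul]
    · simp only [linearWeight, planeWeight, Pi.zero_apply]
      linarith
  · intro ε hε
    have hlim := (tendsto_integral_tail hwμ).add (tendsto_integral_tail hwθ)
    rw [add_zero] at hlim
    obtain ⟨n, hn⟩ := (hlim.eventually (gt_mem_nhds hε)).exists
    have hcont : Continuous fun x => max (linearWeight x - n) 0 :=
      (continuous_linearWeight.sub continuous_const).max continuous_const
    -- `planeWeight` is the sum of the two linear weights minus 1, so one tail at level `n` per
    -- coordinate covers its tail at level 2n.
    refine ⟨2 * n, _, ⟨_, _, 0, hcont, hcont, tail_mem_growthSpace one_le_linearWeight n,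
      tail_mem_growthSpace one_le_linearWeight n, ⟨0, by simp⟩, rfl⟩, fun q => ?_, hn.le⟩
    have h1 := le_max_left (linearWeight q.1 - n) 0
    have h2 := le_max_left (linearWeight q.2 - n) 0
    have h3 := le_max_right (linearWeight q.1 - n) 0
    have h4 := le_max_right (linearWeight q.2 - n) 0
    have h5 : planeWeight q + 1 = linearWeight q.1 + linearWeight q.2 := by
      unfold planeWeight linearWeight
      ring
    simp only [Pi.zero_apply, zero_mul, add_zero, Nat.cast_mul, Nat.cast_ofNat]
    exact ⟨add_nonneg h3 h4, by linarith⟩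

/-- `π` is the law of a one-step martingale with marginals `μ` and `θ`. -/
structure MartingaleCoupling (μ θ : Measure ℝ) (π : Measure (ℝ × ℝ)) : Prop where
  fst : π.map Prod.fst = μ
  snd : π.map Prod.snd = θ
  martingale : ∀ h : ℝ → ℝ, Measurable h → (∃ C, ∀ x, |h x| ≤ C) →
    ∫ p, h p.1 * (p.2 - p.1) ∂π = 0

/-- A signed density whose integral against `h ∘ X` vanishes for all bounded continuous `h` has
vanishing integral against `h ∘ X` for all bounded measurable `h`. -/
theorem integral_comp_mul_eq_zero {Ω : Type*} [MeasurableSpace Ω] {π : Measure Ω} {X D : Ω → ℝ}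
    (hX : Measurable X) (hD : Measurable D) (hDi : Integrable D π)
    (hcont : ∀ φ : BoundedContinuousFunction ℝ ℝ, ∫ p, φ (X p) * D p ∂π = 0) {h : ℝ → ℝ}
    (hh : Measurable h) (hb : ∃ C, ∀ x, |h x| ≤ C) : ∫ p, h (X p) * D p ∂π = 0 := by
  -- The images under `X` of the densities D⁺ and D⁻ are finite measures with equal integrals of
  -- bounded continuous functions. They therefore coincide.
  have hfin : ∀ F : Ω → ℝ, Integrable F π →
      IsFiniteMeasure ((π.withDensity fun p => ENNReal.ofReal (F p)).map X) := fun F hF => by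
    have := isFiniteMeasure_withDensity_ofReal hF.2
    exact Measure.isFiniteMeasure_map _ X
  have hval : ∀ F : Ω → ℝ, Measurable F → ∀ φ : ℝ → ℝ, Measurable φ →
      ∫ x, φ x ∂((π.withDensity fun p => ENNReal.ofReal (F p)).map X) =
        ∫ p, max (F p) 0 * φ (X p) ∂π := fun F hF φ hφ => by
    rw [integral_map hX.aemeasurable hφ.aestronglyMeasurable,
      integral_withDensity_eq_integral_toReal_smul hF.ennreal_ofReal
        (ae_of_all _ fun _ => ENNReal.ofReal_lt_top)]
    simp only [ENNReal.toReal_ofReal', smul_eq_mul]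
  have := hfin D hDi
  have := hfin (fun p => -D p) hDi.neg
  have hint : ∀ F : Ω → ℝ, Integrable F π → ∀ φ : ℝ → ℝ, Measurable φ → (∃ C, ∀ x, |φ x| ≤ C) →
      Integrable (fun p => max (F p) 0 * φ (X p)) π := by
    rintro F hF φ hφ ⟨C, hC⟩
    exact hF.pos_part.mul_bdd (c := C) (hφ.comp hX).aestronglyMeasurable
      (ae_of_all _ fun p => hC _)
  have hdiff : ∀ φ : ℝ → ℝ, Measurable φ → (∃ C, ∀ x, |φ x| ≤ C) →
      ∫ x, φ x ∂((π.withDensity fun p => ENNReal.ofReal (D p)).map X) -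
        ∫ x, φ x ∂((π.withDensity fun p => ENNReal.ofReal (-D p)).map X) =
      ∫ p, φ (X p) * D p ∂π := fun φ hφ hφb => by
    rw [hval D hD φ hφ, hval (fun p => -D p) hD.neg φ hφ,
      ← integral_sub (hint D hDi φ hφ hφb) (hint (fun p => -D p) hDi.neg φ hφ hφb)]
    refine integral_congr_ae (ae_of_all _ fun p => ?_)
    have h1 : max (D p) 0 - max (-D p) 0 = D p := by
      rcases le_total 0 (D p) with h0 | h0
      · rw [max_eq_left h0, max_eq_right (by linarith), sub_zero]
      · rw [max_eq_right h0, max_eq_left (by linarith)]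
        ring
    dsimp only
    rw [← sub_mul, h1, mul_comm]
  have heq : (π.withDensity fun p => ENNReal.ofReal (D p)).map X =
      (π.withDensity fun p => ENNReal.ofReal (-D p)).map X := by
    refine ext_of_forall_integral_eq_of_IsFiniteMeasure fun φ => ?_
    rw [← sub_eq_zero, hdiff φ φ.continuous.measurable ⟨‖φ‖, φ.norm_coe_le_norm⟩, hcont φ]
  rw [← hdiff h hh hb, heq, sub_self]

/-- Strassen's theorem: measures in convex order are the marginals of a martingale. -/
theorem ConvexOrder.exists_martingaleCoupling {μ θ : Measure ℝ} (h : ConvexOrder μ θ) :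
    ∃ π, MartingaleCoupling μ θ π := by
  have := h.finite_left
  have := h.finite_right
  -- Only the price bounds matter, so the target is 0. Applying them to a payoff and its negative
  -- gives the marginals and the martingale property.
  obtain ⟨π, hfin, hw, hle, -⟩ := (hedgingCone_martingale h).exists_measure
    continuous_planeWeight one_le_planeWeight isCompact_planeWeight_le (g := fun _ => 0) (C := 0)
    continuous_const.upperSemicontinuous (by simp)
  have hbdd : ∀ φ : BoundedContinuousFunction ℝ ℝ, ⇑φ ∈ growthSpace linearWeight := fun φ =>
    ⟨‖φ‖, fun x => (φ.norm_coe_le_norm x).trans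
      (le_mul_of_one_le_right (norm_nonneg _) (one_le_linearWeight x))⟩
  have hle' : ∀ a b k : BoundedContinuousFunction ℝ ℝ,
      ∫ q, (a q.1 + b q.2 + k q.1 * (q.2 - q.1)) ∂π ≤ ∫ x, a x ∂μ + ∫ x, b x ∂θ := fun a b k =>
    hle _ ⟨a, b, k, a.continuous, b.continuous, hbdd a, hbdd b,
      ⟨‖k‖, k.norm_coe_le_norm⟩, rfl⟩ (by fun_prop)
  refine ⟨π, ?_, ?_, fun k hk hkb => ?_⟩
  · refine ext_of_forall_integral_eq_of_IsFiniteMeasure fun φ => ?_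
    rw [integral_map (by fun_prop) φ.continuous.aestronglyMeasurable]
    have h1 := hle' φ 0 0
    have h2 := hle' (-φ) 0 0
    simp [integral_neg] at h1 h2
    linarith
  · refine ext_of_forall_integral_eq_of_IsFiniteMeasure fun φ => ?_
    rw [integral_map (by fun_prop) φ.continuous.aestronglyMeasurable]
    have h1 := hle' 0 φ 0
    have h2 := hle' 0 (-φ) 0
    simp [integral_neg] at h1 h2
    linarith
  · refine integral_comp_mul_eq_zero measurable_fst (measurable_snd.sub measurable_fst)
      ?_ (fun φ => ?_) hk hkb
    · refine hw.mono' (by fun_prop) (ae_of_all _ fun q => (abs_sub _ _).trans ?_)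
      unfold planeWeight
      linarith
    · have h1 := hle' 0 0 φ
      have h2 := hle' 0 0 (-φ)
      simp [integral_neg] at h1 h2
      exact le_antisymm h1 h2

/-! ### Integration along a martingale step. -/

namespace MartingaleCoupling

variable {μ θ : Measure ℝ} {π : Measure (ℝ × ℝ)}

theorem isFiniteMeasure (h : MartingaleCoupling μ θ π) [IsFiniteMeasure μ] : IsFiniteMeasure π := by
  refine ⟨?_⟩
  rw [← preimage_univ (f := Prod.fst), ← Measure.map_apply measurable_fst MeasurableSet.univ, h.fst]
  exact measure_lt_top μ _

theorem ae_fst (h : MartingaleCoupling μ θ π) {P : ℝ → Prop} (hP : ∀ᵐ x ∂μ, P x) :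
    ∀ᵐ p ∂π, P p.1 :=
  ae_of_ae_map measurable_fst.aemeasurable (h.fst.symm ▸ hP)

theorem ae_snd (h : MartingaleCoupling μ θ π) {P : ℝ → Prop} (hP : ∀ᵐ x ∂θ, P x) :
    ∀ᵐ p ∂π, P p.2 :=
  ae_of_ae_map measurable_snd.aemeasurable (h.snd.symm ▸ hP)

theorem integrable_fst (h : MartingaleCoupling μ θ π) {g : ℝ → ℝ} (hg : Integrable g μ) :
    Integrable (fun p => g p.1) π := by
  rw [← h.fst] at hg
  exact hg.comp_measurable measurable_fst

theorem integrable_snd (h : MartingaleCoupling μ θ π) {g : ℝ → ℝ} (hg : Integrable g θ) :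
    Integrable (fun p => g p.2) π := by
  rw [← h.snd] at hg
  exact hg.comp_measurable measurable_snd

theorem integral_fst (h : MartingaleCoupling μ θ π) {g : ℝ → ℝ} (hg : AEStronglyMeasurable g μ) :
    ∫ p, g p.1 ∂π = ∫ x, g x ∂μ := by
  rw [← h.fst] at hg ⊢
  exact (integral_map measurable_fst.aemeasurable hg).symm

theorem integral_snd (h : MartingaleCoupling μ θ π) {g : ℝ → ℝ} (hg : AEStronglyMeasurable g θ) :
    ∫ p, g p.2 ∂π = ∫ x, g x ∂θ := by
  rw [← h.snd] at hg ⊢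
  exact (integral_map measurable_snd.aemeasurable hg).symm

theorem lintegral_fst (h : MartingaleCoupling μ θ π) {g : ℝ → ℝ≥0∞} (hg : Measurable g) :
    ∫⁻ p, g p.1 ∂π = ∫⁻ x, g x ∂μ := by
  rw [← h.fst, lintegral_map hg measurable_fst]

theorem lintegral_snd (h : MartingaleCoupling μ θ π) {g : ℝ → ℝ≥0∞} (hg : Measurable g) :
    ∫⁻ p, g p.2 ∂π = ∫⁻ x, g x ∂θ := by
  rw [← h.snd, lintegral_map hg measurable_snd]

theorem integrable_increment (h : MartingaleCoupling μ θ π) (hμ : Integrable (fun x : ℝ => x) μ)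
    (hθ : Integrable (fun x : ℝ => x) θ) : Integrable (fun p => p.2 - p.1) π :=
  (h.integrable_snd hθ).sub (h.integrable_fst hμ)

/-- A martingale that moves only downwards on an event of the first time does not move there. -/
theorem ae_eq_of_le (h : MartingaleCoupling μ θ π) (hμ : Integrable (fun x : ℝ => x) μ)
    (hθ : Integrable (fun x : ℝ => x) θ) {E : Set ℝ} (hE : MeasurableSet E) (s : ℝ)
    (hle : ∀ᵐ p ∂π, p.1 ∈ E → 0 ≤ s * (p.2 - p.1)) (hs : s ≠ 0) :
    ∀ᵐ p ∂π, p.1 ∈ E → p.2 = p.1 := by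
  -- The strategy `s` on `E` has a nonnegative gain of mean zero, which must vanish almost
  -- everywhere.
  have hk : Measurable (E.indicator fun _ => s) := measurable_const.indicator hE
  have hb : ∀ x, |E.indicator (fun _ => s) x| ≤ |s| := fun x => by
    by_cases hx : x ∈ E
    · rw [indicator_of_mem hx]
    · rw [indicator_of_notMem hx, abs_zero]
      exact abs_nonneg _
  have h0 := h.martingale _ hk ⟨_, hb⟩
  have hnn : 0 ≤ᵐ[π] fun p => E.indicator (fun _ => s) p.1 * (p.2 - p.1) := by
    filter_upwards [hle] with p hp
    by_cases hx : p.1 ∈ E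
    · simpa [indicator_of_mem hx] using hp hx
    · simp [indicator_of_notMem hx]
  have hint : Integrable (fun p => E.indicator (fun _ => s) p.1 * (p.2 - p.1)) π :=
    (h.integrable_increment hμ hθ).bdd_mul (c := |s|) (hk.comp measurable_fst).aestronglyMeasurable
      (ae_of_all _ fun p => hb p.1)
  rw [integral_eq_zero_iff_of_nonneg_ae hnn hint] at h0
  filter_upwards [h0] with p hp hx
  simp only [indicator_of_mem hx, Pi.zero_apply, mul_eq_zero, hs, false_or] at hp
  linarith

/-- If a function is dominated, up to a martingale increment, by an integrable function, then so is
its integral; no integrability of the increment is needed. -/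
theorem integral_le_of_le_add_increment (h : MartingaleCoupling μ θ π)
    (hμ : Integrable (fun x : ℝ => x) μ) (hθ : Integrable (fun x : ℝ => x) θ)
    {N G G₀ : ℝ × ℝ → ℝ} {k : ℝ → ℝ} (hN : Integrable N π) (hG : AEStronglyMeasurable G π)
    (hG₀ : Integrable G₀ π) (hk : Measurable k) (hle : ∀ᵐ p ∂π, G₀ p ≤ G p)
    (hGN : ∀ᵐ p ∂π, G p ≤ N p + k p.1 * (p.2 - p.1)) :
    Integrable G π ∧ ∫ p, G p ∂π ≤ ∫ p, N p ∂π := by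
  -- Restricted to `E n` the strategy is bounded, so its increment is integrable with mean zero. The
  -- lower bound `G₀` supports the passage n → ∞.
  set E : ℕ → Set ℝ := fun n => {x | |k x| ≤ n} with hE
  have hEm : ∀ n, MeasurableSet (E n) := fun n => measurableSet_le hk.abs measurable_const
  set κ : ℕ → ℝ × ℝ → ℝ := fun n p => (E n).indicator (fun _ => 1) p.1 with hκ
  have hκm : ∀ n, Measurable (κ n) := fun n =>
    (measurable_const.indicator (hEm n)).comp measurable_fst
  have hκ01 : ∀ n p, κ n p = 0 ∨ κ n p = 1 := fun n p => by
    by_cases hx : p.1 ∈ E n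
    · exact Or.inr (indicator_of_mem hx fun _ => (1 : ℝ))
    · exact Or.inl (indicator_of_notMem hx fun _ => (1 : ℝ))
  have hκb : ∀ n p, ‖κ n p‖ ≤ 1 := fun n p => by
    rcases hκ01 n p with h1 | h1 <;> rw [h1] <;> simp
  have hκ0 : ∀ n p, 0 ≤ κ n p := fun n p => by
    rcases hκ01 n p with h1 | h1 <;> simp [h1]
  have hκlim : ∀ p, ∀ᶠ n in atTop, κ n p = 1 := fun p => by
    obtain ⟨n₀, hn₀⟩ := exists_nat_ge |k p.1|
    filter_upwards [eventually_ge_atTop n₀] with n hn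
    exact indicator_of_mem (show p.1 ∈ E n from hn₀.trans (by exact_mod_cast hn)) fun _ => (1 : ℝ)
  have hNG : Integrable (fun p => N p - G₀ p) π := hN.sub hG₀
  have hmulint : ∀ {F : ℝ × ℝ → ℝ}, Integrable F π → ∀ n, Integrable (fun p => κ n p * F p) π :=
    fun hF n => hF.bdd_mul (c := 1) (hκm n).aestronglyMeasurable (ae_of_all _ (hκb n))
  have hlimmul : ∀ {F : ℝ × ℝ → ℝ}, Integrable F π →
      Tendsto (fun n => ∫ p, κ n p * F p ∂π) atTop (𝓝 (∫ p, F p ∂π)) := fun {F} hF => by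
    refine tendsto_integral_of_dominated_convergence (fun p => ‖F p‖)
      (fun n => (hmulint hF n).1) hF.norm (fun n => ae_of_all _ fun p => ?_)
      (ae_of_all _ fun p => ?_)
    · rw [norm_mul]
      exact mul_le_of_le_one_left (norm_nonneg _) (hκb n p)
    · refine tendsto_const_nhds.congr' ?_
      filter_upwards [hκlim p] with n hn
      rw [hn, one_mul]
  have hkn : ∀ n, Measurable ((E n).indicator k) := fun n => hk.indicator (hEm n)
  have hknb : ∀ n x, |(E n).indicator k x| ≤ n := fun n x => by
    by_cases hx : x ∈ E n
    · rw [indicator_of_mem hx]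
      exact hx
    · rw [indicator_of_notMem hx, abs_zero]
      exact n.cast_nonneg
  have hinc : ∀ n, Integrable (fun p : ℝ × ℝ => (E n).indicator k p.1 * (p.2 - p.1)) π := fun n =>
    (h.integrable_increment hμ hθ).bdd_mul (c := n)
      ((hkn n).comp measurable_fst).aestronglyMeasurable (ae_of_all _ fun p => hknb n p.1)
  have hdom : ∀ n, ∀ᵐ p ∂π, 0 ≤ κ n p * (G p - G₀ p) ∧ κ n p * (G p - G₀ p) ≤
      κ n p * (N p - G₀ p) + (E n).indicator k p.1 * (p.2 - p.1) := fun n => by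
    filter_upwards [hle, hGN] with p h1 h2
    refine ⟨mul_nonneg (hκ0 n p) (sub_nonneg.2 h1), ?_⟩
    by_cases hx : p.1 ∈ E n
    · have : κ n p = 1 := indicator_of_mem hx _
      rw [this, indicator_of_mem hx]
      linarith
    · have : κ n p = 0 := indicator_of_notMem hx _
      rw [this, indicator_of_notMem hx]
      simp
  have hGn : ∀ n, Integrable (fun p => κ n p * (G p - G₀ p)) π := fun n => by
    refine ((hmulint hNG n).add (hinc n)).mono' ((hκm n).aestronglyMeasurable.mul (hG.sub hG₀.1)) ?_
    filter_upwards [hdom n] with p hp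
    rw [Real.norm_of_nonneg hp.1]
    exact hp.2
  have hGle : ∀ n, ∫ p, κ n p * (G p - G₀ p) ∂π ≤ ∫ p, κ n p * (N p - G₀ p) ∂π := fun n => by
    have h1 := integral_mono_ae (hGn n) ((hmulint hNG n).add (hinc n))
      ((hdom n).mono fun p hp => hp.2)
    simp only [Pi.add_apply] at h1
    rwa [integral_add (hmulint hNG n) (hinc n), h.martingale _ (hkn n) ⟨n, hknb n⟩,
      add_zero] at h1
  -- Fatou, with the truncated integrals bounded uniformly by the norm of N - G₀.
  have hGG : Integrable (fun p => G p - G₀ p) π := by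
    refine ⟨hG.sub hG₀.1, ?_⟩
    rw [hasFiniteIntegral_iff_ofReal (hle.mono fun p hp => sub_nonneg.2 hp)]
    refine lt_of_le_of_lt ?_ (ENNReal.ofReal_lt_top (r := ∫ p, ‖N p - G₀ p‖ ∂π))
    calc ∫⁻ p, ENNReal.ofReal (G p - G₀ p) ∂π
        = ∫⁻ p, liminf (fun n => ENNReal.ofReal (κ n p * (G p - G₀ p))) atTop ∂π := by
          congr 1 with p
          refine (Tendsto.liminf_eq (tendsto_const_nhds.congr' ?_)).symm
          filter_upwards [hκlim p] with n hn
          rw [hn, one_mul]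
      _ ≤ liminf (fun n => ∫⁻ p, ENNReal.ofReal (κ n p * (G p - G₀ p)) ∂π) atTop :=
          lintegral_liminf_le' fun n => (hGn n).1.aemeasurable.ennreal_ofReal
      _ ≤ _ := by
          refine liminf_le_of_le (by isBoundedDefault) fun b hb => ?_
          obtain ⟨n, hn⟩ := hb.exists
          refine hn.trans ?_
          rw [← ofReal_integral_eq_lintegral_ofReal (hGn n) ((hdom n).mono fun p hp => hp.1)]
          refine ENNReal.ofReal_le_ofReal ((hGle n).trans ?_)
          refine integral_mono (hmulint hNG n) hNG.norm fun p => ?_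
          refine (le_abs_self _).trans ?_
          rw [abs_mul]
          exact mul_le_of_le_one_left (abs_nonneg _) (hκb n p)
  have hGi : Integrable G π := (hGG.add hG₀).congr (ae_of_all _ fun p => by simp)
  refine ⟨hGi, ?_⟩
  have := le_of_tendsto_of_tendsto' (hlimmul hGG) (hlimmul hNG) hGle
  rw [integral_sub hGi hG₀, integral_sub hN hG₀] at this
  linarith

end MartingaleCoupling

/-! ### Potential functions. -/

section Potential

variable {μ ν : Measure ℝ}

theorem integrable_abs_sub [IsFiniteMeasure μ] (h : Integrable (fun x : ℝ => x) μ) (x : ℝ) :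
    Integrable (fun y => |x - y|) μ :=
  ((integrable_const x).sub h).abs

theorem continuous_potential [IsFiniteMeasure μ] (h : Integrable (fun x : ℝ => x) μ) :
    Continuous (potential μ) := by
  refine (LipschitzWith.of_le_add_mul (μ.real univ).toNNReal fun x x' => ?_).continuous
  have h1 : ∫ y, |x - y| ∂μ ≤ ∫ y, (|x' - y| + dist x x') ∂μ := by
    refine integral_mono (integrable_abs_sub h x)
      ((integrable_abs_sub h x').add (integrable_const _)) fun y => ?_
    rw [Real.dist_eq]
    have := abs_sub_le x x' y
    dsimp only
    linarith
  rw [integral_add (integrable_abs_sub h x') (integrable_const _), integral_const, smul_eq_mul] at h1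
  rwa [Real.coe_toNNReal _ measureReal_nonneg]

theorem ConvexOrder.potential_le (h : ConvexOrder μ ν) (x : ℝ) :
    potential μ x ≤ potential ν x := by
  refine h.integral_le (φ := fun y => |x - y|) ?_ ⟨1 + |x|, fun y => ?_⟩
  · have h1 : ConvexOn ℝ univ fun y : ℝ => dist y x := convexOn_univ_dist x
    simpa only [Real.dist_eq, abs_sub_comm] using h1
  · rw [abs_abs]
    unfold linearWeight
    have := abs_sub x y
    nlinarith [abs_nonneg x, abs_nonneg y, mul_nonneg (abs_nonneg x) (abs_nonneg y)]

theorem ConvexOrder.isOpen_domI (h : ConvexOrder μ ν) : IsOpen (domI μ ν) := by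
  have := h.finite_left
  have := h.finite_right
  exact isOpen_lt (continuous_potential h.moment_left) (continuous_potential h.moment_right)

theorem ConvexOrder.potential_eq (h : ConvexOrder μ ν) {x : ℝ} (hx : x ∉ domI μ ν) :
    potential μ x = potential ν x :=
  le_antisymm (h.potential_le x) (not_lt.1 hx)

/-- `ν` does not charge the half-line beyond a point at which the potentials agree, if `μ` does
not. -/
theorem ConvexOrder.ae_of_potential_eq (h : ConvexOrder μ ν) {x : ℝ} (s : ℝ) (hs : |s| = 1)
    (hx : potential ν x ≤ potential μ x) (hμ : ∀ᵐ y ∂μ, 0 ≤ s * (x - y)) :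
    ∀ᵐ y ∂ν, 0 ≤ s * (x - y) := by
  have := h.finite_left
  have := h.finite_right
  -- This nonnegative function vanishes exactly on the half-line s(x - y) ≥ 0. Its `μ`-integral is
  -- 0, and its `ν`-integral is no larger because the affine parts have equal integrals. The sign
  -- `s` treats both half-lines at once.
  have hle : ∀ y, 0 ≤ |x - y| - s * (x - y) := fun y => by
    rw [sub_nonneg]
    refine (le_abs_self _).trans ?_
    rw [abs_mul, hs, one_mul]
  have hint : ∀ {ρ : Measure ℝ} [IsFiniteMeasure ρ], Integrable (fun x : ℝ => x) ρ →
      Integrable (fun y => |x - y| - s * (x - y)) ρ := fun hρ =>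
    (integrable_abs_sub hρ x).sub (((integrable_const x).sub hρ).const_mul s)
  have hval : ∀ {ρ : Measure ℝ} [IsFiniteMeasure ρ], Integrable (fun x : ℝ => x) ρ →
      ∫ y, (|x - y| - s * (x - y)) ∂ρ = potential ρ x - ∫ y, (-s * y + s * x) ∂ρ := fun {ρ} _ hρ => by
    have hi : Integrable (fun y => s * (x - y)) ρ := ((integrable_const x).sub hρ).const_mul s
    rw [integral_sub (integrable_abs_sub hρ x) hi]
    congr 2 with y
    ring
  have h0 : ∫ y, (|x - y| - s * (x - y)) ∂μ = 0 := by
    refine (integral_congr_ae ?_).trans (integral_zero ℝ ℝ (μ := μ))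
    filter_upwards [hμ] with y hy
    have : |x - y| = s * (x - y) := by
      rw [← abs_of_nonneg hy, abs_mul, hs, one_mul]
    rw [this, sub_self]
  have h1 : ∫ y, (|x - y| - s * (x - y)) ∂ν = 0 := by
    refine le_antisymm ?_ (integral_nonneg hle)
    rw [← h0, hval h.moment_left, hval h.moment_right, h.integral_affine_eq]
    linarith
  rw [integral_eq_zero_iff_of_nonneg hle (hint h.moment_right)] at h1
  filter_upwards [h1] with y hy
  simp only [Pi.zero_apply] at hy
  linarith [abs_nonneg (x - y)]

theorem ConvexOrder.measure_univ_eq (h : ConvexOrder μ ν) : μ univ = ν univ := by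
  have := h.finite_left
  have := h.finite_right
  have h1 := h.integral_affine_eq 0 1
  simp only [zero_mul, zero_add, integral_const, smul_eq_mul, mul_one] at h1
  exact (measureReal_eq_measureReal_iff).1 h1

end Potential

/-! ### Intervals, and where the measures live. -/

section Interval

variable {I : Set ℝ}

theorem forall_lt_or_forall_gt (hI : I.OrdConnected) {x : ℝ} (hx : x ∉ I) :
    (∀ y ∈ I, y < x) ∨ ∀ y ∈ I, x < y := by
  by_contra! hcon
  obtain ⟨⟨a, ha, hxa⟩, b, hb, hbx⟩ := hcon
  exact hx (hI.out hb ha ⟨hbx, hxa⟩)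

theorem le_of_mem_closure {x y : ℝ} (hx : ∀ z ∈ I, z < x) (hy : y ∈ closure I) : y ≤ x :=
  closure_minimal (fun z hz => (hx z hz).le) isClosed_Iic hy

theorem ge_of_mem_closure {x y : ℝ} (hx : ∀ z ∈ I, x < z) (hy : y ∈ closure I) : x ≤ y :=
  closure_minimal (fun z hz => (hx z hz).le) isClosed_Ici hy

theorem mem_of_between (hI : I.OrdConnected) {x y z : ℝ} (hx : x ∈ closure I) (hy : y ∈ closure I)
    (hxz : x < z) (hzy : z < y) : z ∈ I := by
  by_contra hz
  rcases forall_lt_or_forall_gt hI hz with h | h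
  · exact absurd (le_of_mem_closure h hy) (not_le.2 hzy)
  · exact absurd (ge_of_mem_closure h hx) (not_le.2 hxz)

theorem countable_closure_diff (hI : I.OrdConnected) : (closure I \ I).Countable := by
  have h1 : {x | x ∈ closure I ∧ ∀ z ∈ I, z < x}.Subsingleton := fun x hx y hy =>
    le_antisymm (le_of_mem_closure hy.2 hx.1) (le_of_mem_closure hx.2 hy.1)
  have h2 : {x | x ∈ closure I ∧ ∀ z ∈ I, x < z}.Subsingleton := fun x hx y hy =>
    le_antisymm (ge_of_mem_closure hx.2 hy.1) (ge_of_mem_closure hy.2 hx.1)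
  refine (h1.countable.union h2.countable).mono fun x hx => ?_
  rcases forall_lt_or_forall_gt hI hx.2 with h | h
  · exact Or.inl ⟨hx.1, h⟩
  · exact Or.inr ⟨hx.1, h⟩

theorem ordConnected_of_subset_closure (hI : I.OrdConnected) {J : Set ℝ} (hIJ : I ⊆ J)
    (hJ : J ⊆ closure I) : J.OrdConnected := by
  refine ⟨fun x hx y hy z hz => ?_⟩
  rcases eq_or_lt_of_le hz.1 with rfl | h1
  · exact hx
  rcases eq_or_lt_of_le hz.2 with rfl | h2
  · exact hy
  exact hIJ (mem_of_between hI (hJ hx) (hJ hy) h1 h2)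

/-- A martingale that ends in the closure of an interval `I` does not move once it is outside
`I`. -/
theorem MartingaleCoupling.ae_eq_of_notMem {θ ν : Measure ℝ} {π : Measure (ℝ × ℝ)}
    (h : MartingaleCoupling θ ν π) (hθ : Integrable (fun x : ℝ => x) θ)
    (hν : Integrable (fun x : ℝ => x) ν) (hI : I.OrdConnected) (hc : ∀ᵐ y ∂ν, y ∈ closure I) :
    ∀ᵐ p ∂π, p.1 ∉ I → p.2 = p.1 := by
  have hc' := h.ae_snd hc
  -- From a point to the right of `I` the martingale can only move left; `h2` is the mirror image.
  have h1 : ∀ᵐ p ∂π, p.1 ∈ {x | ∀ y ∈ I, y < x} → p.2 = p.1 := by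
    refine h.ae_eq_of_le hθ hν (OrdConnected.measurableSet ⟨fun x hx y _ z hz w hw =>
      (hx w hw).trans_le hz.1⟩) (-1) ?_ (by norm_num)
    filter_upwards [hc'] with p hp hx
    linarith [le_of_mem_closure hx hp]
  have h2 : ∀ᵐ p ∂π, p.1 ∈ {x | ∀ y ∈ I, x < y} → p.2 = p.1 := by
    refine h.ae_eq_of_le hθ hν (OrdConnected.measurableSet ⟨fun x _ y hy z hz w hw =>
      hz.2.trans_lt (hy w hw)⟩) 1 ?_ (by norm_num)
    filter_upwards [hc'] with p hp hx
    linarith [ge_of_mem_closure hx hp]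
  filter_upwards [h1, h2] with p hp1 hp2 hx
  rcases forall_lt_or_forall_gt hI hx with h | h
  · exact hp1 h
  · exact hp2 h

end Interval

section Domain

variable {μ ν : Measure ℝ}

theorem domI_subset_domJ : domI μ ν ⊆ domJ μ ν := subset_union_left

theorem domJ_subset_closure : domJ μ ν ⊆ closure (domI μ ν) :=
  union_subset subset_closure fun _ hx => frontier_subset_closure hx.1

namespace Irreducible

theorem ordConnected (h : Irreducible μ ν) : (domI μ ν).OrdConnected := h.connected.ordConnected

theorem ae_mem_domI (h : Irreducible μ ν) : ∀ᵐ x ∂μ, x ∈ domI μ ν := by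
  have := h.order.finite_left
  exact (ae_iff_measure_eq h.order.isOpen_domI.measurableSet.nullMeasurableSet).2 h.concentrated

theorem measurableSet_domJ (h : Irreducible μ ν) : MeasurableSet (domJ μ ν) :=
  (ordConnected_of_subset_closure h.ordConnected domI_subset_domJ domJ_subset_closure).measurableSet

/-- Between an outside point and `I` lies a point, half the distance ε away, that is still outside
`I`. The potentials agree there and `μ` has no mass beyond it, so neither has `ν`. Thus every
outside point has a `ν`-null neighbourhood. -/
theorem ae_mem_closure (h : Irreducible μ ν) : ∀ᵐ x ∂ν, x ∈ closure (domI μ ν) := by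
  refine measure_null_of_locally_null _ fun x hx => ?_
  obtain ⟨ε, hε, hb⟩ := Metric.isOpen_iff.1 isClosed_closure.isOpen_compl x hx
  have hout : ∀ y, |y - x| < ε → y ∉ domI μ ν := fun y hy hyI =>
    hb (by rwa [Metric.mem_ball, Real.dist_eq]) (subset_closure hyI)
  have key : ∀ s : ℝ, |s| = 1 → (∀ y ∈ domI μ ν, 0 ≤ s * (x - y)) →
      ν {y | s * (x - s * (ε / 2) - y) < 0} = 0 := by
    intro s hs hy
    have hss : s * s = 1 := by rw [← abs_mul_abs_self, hs, one_mul]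
    have hz : x - s * (ε / 2) ∉ domI μ ν := hout _ (by
      rw [sub_sub_cancel_left, abs_neg, abs_mul, hs, one_mul, abs_of_pos (by linarith)]
      linarith)
    have := h.order.ae_of_potential_eq (x := x - s * (ε / 2)) s hs (h.order.potential_eq hz).ge (by
      filter_upwards [h.ae_mem_domI] with y hyI
      have h1 := hy y hyI
      have h2 : ε ≤ |y - x| := not_lt.1 fun h => hout y h hyI
      rw [abs_sub_comm, ← one_mul |x - y|, ← hs, ← abs_mul, abs_of_nonneg h1] at h2
      nlinarith)
    simpa only [ae_iff, not_le] using this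
  rcases forall_lt_or_forall_gt h.ordConnected (fun hxI => hx (subset_closure hxI)) with hlt | hgt
  · refine ⟨_, mem_nhdsWithin_of_mem_nhds (IsOpen.mem_nhds ?_ ?_),
      key 1 (by simp) fun y hy => by linarith [hlt y hy]⟩
    · exact isOpen_lt (by fun_prop) continuous_const
    · simp only [mem_ofPred_eq]
      linarith
  · refine ⟨_, mem_nhdsWithin_of_mem_nhds (IsOpen.mem_nhds ?_ ?_),
      key (-1) (by simp) fun y hy => by linarith [hgt y hy]⟩
    · exact isOpen_lt (by fun_prop) continuous_const
    · simp only [mem_ofPred_eq]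
      linarith

theorem countable_domJ_diff (h : Irreducible μ ν) : (domJ μ ν \ domI μ ν).Countable :=
  (countable_closure_diff h.ordConnected).mono (sdiff_subset_sdiff_left domJ_subset_closure)

/-- The closure exceeds `J` only by countably many points without `ν`-mass. -/
theorem ae_mem_domJ (h : Irreducible μ ν) : ∀ᵐ x ∂ν, x ∈ domJ μ ν := by
  have hnull : ν {x | x ∈ closure (domI μ ν) \ domI μ ν ∧ ν {x} = 0} = 0 := by
    have hc : {x | x ∈ closure (domI μ ν) \ domI μ ν ∧ ν {x} = 0}.Countable :=
      (countable_closure_diff h.ordConnected).mono fun x hx => hx.1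
    rw [← biUnion_of_singleton {x | x ∈ closure (domI μ ν) \ domI μ ν ∧ ν {x} = 0},
      measure_biUnion_null_iff hc]
    exact fun x hx => hx.2
  filter_upwards [h.ae_mem_closure, measure_eq_zero_iff_ae_notMem.1 hnull] with x hx hx'
  by_cases hxI : x ∈ domI μ ν
  · exact Or.inl hxI
  · refine Or.inr ⟨⟨hx, ?_⟩, fun h0 => hx' ⟨⟨hx, hxI⟩, h0⟩⟩
    rwa [h.order.isOpen_domI.interior_eq]

end Irreducible

end Domain

/-! ### Tangents and Taylor's formula for concave functions. -/

section Derivative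

variable {I J : Set ℝ} {χ : ℝ → ℝ}

theorem hasDerivWithinAt_rightDeriv (hI : IsOpen I) (hIJ : I ⊆ J) (hχ : ConcaveOn ℝ J χ) {x : ℝ}
    (hx : x ∈ I) : HasDerivWithinAt χ (rightDeriv χ x) (Ioi x) x := by
  have h := hχ.neg.hasDerivWithinAt_rightDeriv_of_mem_interior (interior_maximal hIJ hI hx)
  have h' := h.neg
  rw [neg_neg] at h'
  exact h'.differentiableWithinAt.hasDerivWithinAt

theorem derivWithin_neg_eq_neg_rightDeriv (χ : ℝ → ℝ) (x : ℝ) :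
    derivWithin (-χ) (Ioi x) x = -rightDeriv χ x := by
  rw [rightDeriv, ← derivWithin.neg]

theorem antitoneOn_rightDeriv (hI : IsOpen I) (hχ : ConcaveOn ℝ I χ) :
    AntitoneOn (rightDeriv χ) I := by
  have h := hχ.neg.monotoneOn_rightDeriv
  rw [hI.interior_eq] at h
  intro x hx y hy hxy
  have := h hx hy hxy
  simp only [derivWithin_neg_eq_neg_rightDeriv] at this
  linarith

/-- A concave function lies below its tangents. -/
theorem le_tangent (hI : IsOpen I) (hIJ : I ⊆ J) (hχ : ConcaveOn ℝ J χ) {x y : ℝ} (hx : x ∈ I)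
    (hy : y ∈ J) : χ y ≤ χ x + rightDeriv χ x * (y - x) := by
  have hxi := interior_maximal hIJ hI hx
  rcases lt_trichotomy x y with h | rfl | h
  · have := hχ.neg.rightDeriv_le_slope_of_mem_interior hxi hy h
    rw [derivWithin_neg_eq_neg_rightDeriv, slope_def_field, le_div_iff₀ (by linarith)] at this
    simp only [Pi.neg_apply] at this
    linarith
  · simp
  · have := (hχ.neg.slope_le_leftDeriv_of_mem_interior hy hxi h).trans
      (hχ.neg.leftDeriv_le_rightDeriv_of_mem_interior hxi)
    rw [derivWithin_neg_eq_neg_rightDeriv, slope_def_field, div_le_iff₀ (by linarith)] at this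
    simp only [Pi.neg_apply] at this
    linarith

theorem measurable_rightDeriv (χ : ℝ → ℝ) : Measurable (rightDeriv χ) :=
  measurable_derivWithin_Ioi χ

theorem integral_rightDeriv (hI : IsOpen I) (hc : I.OrdConnected) (hχ : ConcaveOn ℝ I χ) {x y : ℝ}
    (hx : x ∈ I) (hy : y ∈ I) (hxy : x ≤ y) :
    IntegrableOn (rightDeriv χ) (Icc x y) ∧ ∫ t in x..y, rightDeriv χ t = χ y - χ x := by
  have hsub : Icc x y ⊆ I := hc.out hx hy
  have hint : IntegrableOn (rightDeriv χ) (Icc x y) :=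
    ((antitoneOn_rightDeriv hI hχ).mono hsub).integrableOn_isCompact isCompact_Icc
  refine ⟨hint, intervalIntegral.integral_eq_sub_of_hasDeriv_right_of_le_real hxy
    ((hχ.continuousOn hI).mono hsub) (fun t ht => ?_) hint⟩
  exact hasDerivWithinAt_rightDeriv hI subset_rfl hχ (hsub (Ioo_subset_Icc_self ht))

/-- This licenses Tonelli's theorem for -χ''. Rational intervals with endpoints in `I` have finite
mass and cover `I`, and the complement is null. -/
theorem IsNegSecondDeriv.sigmaFinite {m : Measure ℝ} (hI : IsOpen I) (hm : IsNegSecondDeriv I χ m) :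
    SigmaFinite m := by
  set S : Set (Set ℝ) := insert Iᶜ ((fun p : ℚ × ℚ => Ioc (p.1 : ℝ) p.2) ''
    {p | (p.1 : ℝ) ∈ I ∧ (p.2 : ℝ) ∈ I}) with hS
  refine Measure.sigmaFinite_of_countable (S := S) (((to_countable _).image _).insert _) ?_ ?_
  · rintro s (rfl | ⟨p, ⟨h1, h2⟩, rfl⟩)
    · rw [hm.1]
      exact ENNReal.zero_lt_top
    · dsimp only
      rcases lt_or_ge (p.1 : ℝ) p.2 with h | h
      · rw [hm.2 _ h1 _ h2 h]
        exact ENNReal.ofReal_lt_top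
      · rw [Ioc_eq_empty (not_lt.2 h), measure_empty]
        exact ENNReal.zero_lt_top
  · refine eq_univ_of_forall fun x => ?_
    by_cases hx : x ∈ I
    · obtain ⟨l, u, ⟨hl, hu⟩, hlu⟩ := mem_nhds_iff_exists_Ioo_subset.1 (hI.mem_nhds hx)
      obtain ⟨a, ha1, ha2⟩ := exists_rat_btwn hl
      obtain ⟨b, hb1, hb2⟩ := exists_rat_btwn hu
      exact mem_sUnion.2 ⟨_, Or.inr ⟨(a, b), ⟨hlu ⟨ha1, ha2.trans hu⟩, hlu ⟨hl.trans hb1, hb2⟩⟩,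
        rfl⟩, ha2, hb1.le⟩
    · exact mem_sUnion.2 ⟨_, Or.inl rfl, hx⟩

/-- The Peano kernel of the first-order Taylor expansion from `x` to `y`. -/
def taylorKernel (x y t : ℝ) : ℝ := if x < t then max (y - t) 0 else max (t - y) 0

theorem taylorKernel_nonneg (x y t : ℝ) : 0 ≤ taylorKernel x y t := by
  unfold taylorKernel
  split_ifs <;> exact le_max_right _ _

theorem measurable_taylorKernel :
    Measurable fun q : (ℝ × ℝ) × ℝ => taylorKernel q.1.1 q.1.2 q.2 := by
  unfold taylorKernel
  exact Measurable.ite (measurableSet_lt (by fun_prop) (by fun_prop)) (by fun_prop) (by fun_prop)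

/-- The kernel grows as its target moves away from `x`. With its mirror image, this extends
estimates from `I` to its endpoints by a limit. -/
theorem taylorKernel_mono_right {x y z : ℝ} (hxz : x ≤ z) (hzy : z ≤ y) (t : ℝ) :
    taylorKernel x z t ≤ taylorKernel x y t := by
  unfold taylorKernel
  split_ifs with h
  · exact max_le_max (by linarith) le_rfl
  · rw [max_eq_right (by linarith)]
    exact le_max_right _ _

theorem taylorKernel_mono_left {x y z : ℝ} (hzx : z ≤ x) (hyz : y ≤ z) (t : ℝ) :
    taylorKernel x z t ≤ taylorKernel x y t := by
  unfold taylorKernel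
  split_ifs with h
  · rw [max_eq_right (by linarith)]
    exact le_max_right _ _
  · exact max_le_max (by linarith) le_rfl

/-- Taylor's formula with the second derivative measure. -/
theorem ofReal_tangent_sub {m : Measure ℝ} (hI : IsOpen I) (hc : I.OrdConnected)
    (hχ : ConcaveOn ℝ I χ) (hm : IsNegSecondDeriv I χ m) {x y : ℝ} (hx : x ∈ I) (hy : y ∈ I) :
    ENNReal.ofReal (χ x + rightDeriv χ x * (y - x) - χ y) =
      ∫⁻ t, ENNReal.ofReal (taylorKernel x y t) ∂m := by
  have := hm.sigmaFinite hI
  have hanti := antitoneOn_rightDeriv hI hχ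
  rcases lt_trichotomy x y with hxy | rfl | hxy
  · obtain ⟨hint, heq⟩ := integral_rightDeriv hI hc hχ hx hy hxy.le
    have hint' : IntegrableOn (rightDeriv χ) (Ioc x y) := hint.mono_set Ioc_subset_Icc_self
    have hval : χ x + rightDeriv χ x * (y - x) - χ y =
        ∫ t in Ioc x y, (rightDeriv χ x - rightDeriv χ t) := by
      rw [integral_sub (integrable_const _) hint', ← intervalIntegral.integral_of_le hxy.le,
        ← intervalIntegral.integral_of_le hxy.le, heq, intervalIntegral.integral_const, smul_eq_mul]
      ring
    have hsub : Ioc x y ⊆ I := Ioc_subset_Icc_self.trans (hc.out hx hy)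
    have hi : IntegrableOn (fun t => rightDeriv χ x - rightDeriv χ t) (Ioc x y) :=
      (integrable_const _).sub hint'
    rw [hval, ofReal_integral_eq_lintegral_ofReal hi
      ((ae_restrict_iff' measurableSet_Ioc).2 (ae_of_all _ fun t ht =>
        sub_nonneg.2 (hanti hx (hsub ht) ht.1.le)))]
    -- The drop of the derivative is the mass of (x, t]. Exchanging the integrals leaves, for each
    -- s, the length of the set of t with s ≤ t ≤ y, which is the kernel.
    have h1 : ∀ t ∈ Ioc x y, ENNReal.ofReal (rightDeriv χ x - rightDeriv χ t) =
        ∫⁻ s, (Ioc x t).indicator 1 s ∂m := fun t ht => by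
      rw [lintegral_indicator_one measurableSet_Ioc, hm.2 x hx t (hsub ht) ht.1]
    rw [setLIntegral_congr_fun measurableSet_Ioc h1, lintegral_lintegral_swap]
    · refine lintegral_congr fun s => ?_
      have h2 : ∀ t, (Ioc x t).indicator (1 : ℝ → ℝ≥0∞) s =
          ({t | x < s ∧ s ≤ t} : Set ℝ).indicator 1 t := fun t => by
        simp only [indicator_apply, mem_Ioc, mem_ofPred_eq, Pi.one_apply]
      simp only [h2]
      have hms : MeasurableSet {t | x < s ∧ s ≤ t} := by measurability
      rw [lintegral_indicator_one hms, Measure.restrict_apply hms]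
      unfold taylorKernel
      split_ifs with h
      · have : {t | x < s ∧ s ≤ t} ∩ Ioc x y = Icc s y := by
          ext t
          simp only [mem_inter_iff, mem_ofPred_eq, mem_Ioc, mem_Icc]
          exact ⟨fun h' => ⟨h'.1.2, h'.2.2⟩, fun h' => ⟨⟨h, h'.1⟩, h.trans_le h'.1, h'.2⟩⟩
        rw [this, Real.volume_Icc, ENNReal.ofReal_max, ENNReal.ofReal_zero, max_eq_left zero_le]
      · have : {t | x < s ∧ s ≤ t} = ∅ := by
          ext t
          simp [h]
        rw [this, empty_inter, measure_empty, max_eq_right (by linarith), ENNReal.ofReal_zero]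
    · have hms : MeasurableSet {q : ℝ × ℝ | x < q.2 ∧ q.2 ≤ q.1} := by measurability
      have : (Function.uncurry fun t s => (Ioc x t).indicator (1 : ℝ → ℝ≥0∞) s) =
          {q : ℝ × ℝ | x < q.2 ∧ q.2 ≤ q.1}.indicator 1 := by
        ext q
        simp only [Function.uncurry, indicator_apply, mem_Ioc, mem_ofPred_eq, Pi.one_apply]
      rw [this]
      exact (measurable_one.indicator hms).aemeasurable
  · have : ∀ t, taylorKernel x x t = 0 := fun t => by
      unfold taylorKernel
      split_ifs with h
      · exact max_eq_right (by linarith)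
      · exact max_eq_right (by linarith)
    simp [this]
  · obtain ⟨hint, heq⟩ := integral_rightDeriv hI hc hχ hy hx hxy.le
    have hint' : IntegrableOn (rightDeriv χ) (Ioc y x) := hint.mono_set Ioc_subset_Icc_self
    have hval : χ x + rightDeriv χ x * (y - x) - χ y =
        ∫ t in Ioc y x, (rightDeriv χ t - rightDeriv χ x) := by
      rw [integral_sub hint' (integrable_const _), ← intervalIntegral.integral_of_le hxy.le,
        ← intervalIntegral.integral_of_le hxy.le, heq, intervalIntegral.integral_const, smul_eq_mul]
      ring
    have hsub : Ioc y x ⊆ I := Ioc_subset_Icc_self.trans (hc.out hy hx)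
    have hi : IntegrableOn (fun t => rightDeriv χ t - rightDeriv χ x) (Ioc y x) :=
      hint'.sub (integrable_const _)
    rw [hval, ofReal_integral_eq_lintegral_ofReal hi
      ((ae_restrict_iff' measurableSet_Ioc).2 (ae_of_all _ fun t ht =>
        sub_nonneg.2 (hanti (hsub ht) hx ht.2)))]
    have h1 : ∀ t ∈ Ioc y x, ENNReal.ofReal (rightDeriv χ t - rightDeriv χ x) =
        ∫⁻ s, (Ioc t x).indicator 1 s ∂m := fun t ht => by
      rw [lintegral_indicator_one measurableSet_Ioc]
      rcases eq_or_lt_of_le ht.2 with rfl | h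
      · simp
      · rw [hm.2 t (hsub ht) x hx h]
    rw [setLIntegral_congr_fun measurableSet_Ioc h1, lintegral_lintegral_swap]
    · refine lintegral_congr fun s => ?_
      have h2 : ∀ t, (Ioc t x).indicator (1 : ℝ → ℝ≥0∞) s =
          ({t | t < s ∧ s ≤ x} : Set ℝ).indicator 1 t := fun t => by
        simp only [indicator_apply, mem_Ioc, mem_ofPred_eq, Pi.one_apply]
      simp only [h2]
      have hms : MeasurableSet {t | t < s ∧ s ≤ x} := by measurability
      rw [lintegral_indicator_one hms, Measure.restrict_apply hms]
      unfold taylorKernel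
      split_ifs with h
      · have : {t | t < s ∧ s ≤ x} = ∅ := by
          ext t
          simp [h]
        rw [this, empty_inter, measure_empty, max_eq_right (by linarith), ENNReal.ofReal_zero]
      · have : {t | t < s ∧ s ≤ x} ∩ Ioc y x = Ioo y s := by
          ext t
          simp only [mem_inter_iff, mem_ofPred_eq, mem_Ioc, mem_Ioo]
          rw [not_lt] at h
          exact ⟨fun h' => ⟨h'.2.1, h'.1.1⟩, fun h' => ⟨⟨h'.2, h⟩, h'.1, h'.2.le.trans h⟩⟩
        rw [this, Real.volume_Ioo, ENNReal.ofReal_max, ENNReal.ofReal_zero, max_eq_left zero_le]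
    · have hms : MeasurableSet {q : ℝ × ℝ | q.1 < q.2 ∧ q.2 ≤ x} := by measurability
      have : (Function.uncurry fun t s => (Ioc t x).indicator (1 : ℝ → ℝ≥0∞) s) =
          {q : ℝ × ℝ | q.1 < q.2 ∧ q.2 ≤ x}.indicator 1 := by
        ext q
        simp only [Function.uncurry, indicator_apply, mem_Ioc, mem_ofPred_eq, Pi.one_apply]
      rw [this]
      exact (measurable_one.indicator hms).aemeasurable

end Derivative

/-! ### The gap between a concave function and its tangent. -/

section Gap

variable {I J : Set ℝ} {χ : ℝ → ℝ}

/-- A concave function on an interval has a limit at the endpoints that belong to its domain. -/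
theorem exists_tendsto_endpoint {m : Measure ℝ} (hI : IsOpen I) (hc : I.OrdConnected) (hIJ : I ⊆ J)
    (hχ : ConcaveOn ℝ J χ) (hm : IsNegSecondDeriv I χ m) {x y : ℝ} (hx : x ∈ I)
    (hyJ : y ∈ J) (hyI : y ∉ I) (hy : y ∈ closure I) : ∃ l, Tendsto χ (𝓝[I] y) (𝓝 l) := by
  have hχI : ConcaveOn ℝ I χ := hχ.subset hIJ hc.convex
  -- By Taylor's formula the distance to the tangent at `x` increases towards the endpoint. It is
  -- bounded because χ stays above the smaller of its end values on the segment, so it converges.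
  set g : ℝ → ℝ := fun z => χ x + rightDeriv χ x * (z - x) - χ z with hg
  have hg0 : ∀ z ∈ I, 0 ≤ g z := fun z hz => sub_nonneg.2 (le_tangent hI hIJ hχ hx (hIJ hz))
  have hgT : ∀ z ∈ I, ∀ z' ∈ I, (∀ t, taylorKernel x z t ≤ taylorKernel x z' t) → g z ≤ g z' := by
    intro z hz z' hz' h
    rw [← ENNReal.ofReal_le_ofReal_iff (hg0 z' hz'), hg, ofReal_tangent_sub hI hc hχI hm hx hz,
      ofReal_tangent_sub hI hc hχI hm hx hz']
    exact lintegral_mono fun t => ENNReal.ofReal_le_ofReal (h t)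
  have hbd : ∀ z ∈ segment ℝ x y,
      g z ≤ χ x + |rightDeriv χ x| * |y - x| - min (χ x) (χ y) := by
    intro z hz
    have h1 := hχ.ge_on_segment (hIJ hx) hyJ hz
    have h2 : |z - x| ≤ |y - x| := by
      rw [segment_eq_uIcc] at hz
      exact abs_sub_left_of_mem_uIcc hz
    have h3 : rightDeriv χ x * (z - x) ≤ |rightDeriv χ x| * |y - x| := by
      refine (le_abs_self _).trans ?_
      rw [abs_mul]
      gcongr
    rw [hg]
    dsimp only
    linarith
  have hfin : ∀ {l : ℝ} {F : Filter ℝ}, Tendsto g F (𝓝 l) → F ≤ 𝓝 y →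
      Tendsto χ F (𝓝 (χ x + rightDeriv χ x * (y - x) - l)) := fun {l F} h hF => by
    have h1 : Tendsto (fun z => χ x + rightDeriv χ x * (z - x)) F
        (𝓝 (χ x + rightDeriv χ x * (y - x))) :=
      Tendsto.mono_left (Continuous.tendsto (by fun_prop) y) hF
    refine (h1.sub h).congr fun z => ?_
    rw [hg]
    ring
  rcases forall_lt_or_forall_gt hc hyI with h | h
  · have hsub : Ioo x y ⊆ I := fun z hz => mem_of_between hc (subset_closure hx) hy hz.1 hz.2
    have hlim := MonotoneOn.tendsto_nhdsWithin_Ioo_left (f := g) (nonempty_Ioo.2 (h x hx))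
      (fun z hz z' hz' hzz => hgT z (hsub hz) z' (hsub hz') fun t =>
        taylorKernel_mono_right hz.1.le hzz t)
      ⟨_, by
        rintro _ ⟨z, hz, rfl⟩
        refine hbd z ?_
        rw [segment_eq_Icc (h x hx).le]
        exact Ioo_subset_Icc_self hz⟩
    exact ⟨_, hfin (hlim.mono_left (nhdsWithin_mono y h)) nhdsWithin_le_nhds⟩
  · have hsub : Ioo y x ⊆ I := fun z hz => mem_of_between hc hy (subset_closure hx) hz.1 hz.2
    have hlim := AntitoneOn.tendsto_nhdsWithin_Ioo_right (f := g) (nonempty_Ioo.2 (h x hx))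
      (fun z hz z' hz' hzz => hgT z' (hsub hz') z (hsub hz) fun t =>
        taylorKernel_mono_left hz'.2.le hzz t)
      ⟨_, by
        rintro _ ⟨z, hz, rfl⟩
        refine hbd z ?_
        rw [segment_symm, segment_eq_Icc (h x hx).le]
        exact Ioo_subset_Icc_self hz⟩
    exact ⟨_, hfin (hlim.mono_left (nhdsWithin_mono y h)) nhdsWithin_le_nhds⟩

/-- The size of the jumps of `χ` at the points of `J \ I`, extended by zero. -/
def jumpOn (I J : Set ℝ) (χ : ℝ → ℝ) : ℝ → ℝ≥0∞ :=
  (J \ I).indicator fun y => ENNReal.ofReal (jump I χ y)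

theorem measurable_jumpOn (h : (J \ I).Countable) : Measurable (jumpOn I J χ) := by
  refine (measurable_const (a := (0 : ℝ≥0∞))).measurable_of_countable_ne (h.mono fun y hy => ?_)
  by_contra hyJ
  exact hy (indicator_of_notMem hyJ _).symm

/-- The distance between a concave function and its tangent is controlled by its second derivative
measure and its jumps. -/
theorem ofReal_tangent_sub_le {m : Measure ℝ} (hI : IsOpen I) (hc : I.OrdConnected) (hIJ : I ⊆ J)
    (hJ : J ⊆ closure I) (hχ : ConcaveOn ℝ J χ) (hm : IsNegSecondDeriv I χ m) {x y : ℝ}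
    (hx : x ∈ I) (hy : y ∈ J) :
    ENNReal.ofReal (χ x + rightDeriv χ x * (y - x) - χ y) ≤
      ∫⁻ t, ENNReal.ofReal (taylorKernel x y t) ∂m + jumpOn I J χ y := by
  have hχI : ConcaveOn ℝ I χ := hχ.subset hIJ hc.convex
  by_cases hyI : y ∈ I
  · rw [ofReal_tangent_sub hI hc hχI hm hx hyI]
    exact le_self_add
  obtain ⟨l, hl⟩ := exists_tendsto_endpoint hI hc hIJ hχ hm hx hy hyI (hJ hy)
  have hne : (𝓝[I] y).NeBot := mem_closure_iff_nhdsWithin_neBot.1 (hJ hy)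
  have hjump : jumpOn I J χ y = ENNReal.ofReal |χ y - l| := by
    rw [jumpOn, indicator_of_mem (show y ∈ J \ I from ⟨hy, hyI⟩), jump, hl.limUnder_eq]
  have hlim : Tendsto (fun z => ENNReal.ofReal (χ x + rightDeriv χ x * (z - x) - χ z)) (𝓝[I] y)
      (𝓝 (ENNReal.ofReal (χ x + rightDeriv χ x * (y - x) - l))) := by
    refine (ENNReal.continuous_ofReal.tendsto _).comp (Tendsto.sub ?_ hl)
    exact (Continuous.tendsto (by fun_prop) y).mono_left nhdsWithin_le_nhds
  have hkey : ∀ᶠ z in 𝓝[I] y, ∀ t, taylorKernel x z t ≤ taylorKernel x y t := by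
    rcases forall_lt_or_forall_gt hc hyI with h | h
    · filter_upwards [self_mem_nhdsWithin, mem_nhdsWithin_of_mem_nhds (Ioi_mem_nhds (h x hx))]
        with z hz hxz t
      exact taylorKernel_mono_right (le_of_lt hxz) (h z hz).le t
    · filter_upwards [self_mem_nhdsWithin, mem_nhdsWithin_of_mem_nhds (Iio_mem_nhds (h x hx))]
        with z hz hxz t
      exact taylorKernel_mono_left (le_of_lt hxz) (h z hz).le t
  have hle : ENNReal.ofReal (χ x + rightDeriv χ x * (y - x) - l) ≤
      ∫⁻ t, ENNReal.ofReal (taylorKernel x y t) ∂m := by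
    refine le_of_tendsto hlim ?_
    filter_upwards [self_mem_nhdsWithin, hkey] with z hz hzt
    rw [ofReal_tangent_sub hI hc hχI hm hx hz]
    exact lintegral_mono fun t => ENNReal.ofReal_le_ofReal (hzt t)
  rw [hjump]
  -- The tangent exceeds `χ y` by its excess over the interior limit `l` plus at most the jump.
  refine le_trans ?_ (add_le_add_left hle _)
  refine le_trans (ENNReal.ofReal_le_ofReal ?_) ENNReal.ofReal_add_le
  linarith [neg_abs_le (χ y - l)]

/-- Averaging the Taylor kernel over a martingale gives half the difference of the potentials. -/
theorem MartingaleCoupling.lintegral_taylorKernel {μ θ : Measure ℝ} {π : Measure (ℝ × ℝ)}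
    (h : MartingaleCoupling μ θ π) (hμθ : ConvexOrder μ θ) (t : ℝ) :
    ∫⁻ p, ENNReal.ofReal (taylorKernel p.1 p.2 t) ∂π =
      2⁻¹ * ENNReal.ofReal (potential θ t - potential μ t) := by
  have := hμθ.finite_left
  have := hμθ.finite_right
  -- σ(x) is a subgradient at x of y ↦ |t - y|, and twice the kernel is the excess of this function
  -- over its supporting line. The linear term is a bounded strategy and integrates to zero.
  set σ : ℝ → ℝ := fun x => if x < t then -1 else 1 with hσ
  have hσm : Measurable σ := Measurable.ite (measurableSet_lt measurable_id measurable_const)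
    measurable_const measurable_const
  have hσb : ∀ x, |σ x| ≤ 1 := fun x => by
    rw [hσ]
    dsimp only
    split_ifs <;> simp
  have hT : ∀ p : ℝ × ℝ, taylorKernel p.1 p.2 t =
      2⁻¹ * (|t - p.2| - |t - p.1| - σ p.1 * (p.2 - p.1)) := fun p => by
    unfold taylorKernel
    rw [hσ]
    dsimp only
    split_ifs with hlt
    · rw [abs_of_pos (sub_pos.2 hlt)]
      rcases le_total p.2 t with h1 | h1
      · rw [max_eq_right (by linarith), abs_of_nonneg (by linarith)]
        ring
      · rw [max_eq_left (by linarith), abs_of_nonpos (by linarith)]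
        ring
    · rw [abs_of_nonpos (by linarith : t - p.1 ≤ 0)]
      rcases le_total p.2 t with h1 | h1
      · rw [max_eq_left (by linarith), abs_of_nonneg (by linarith)]
        ring
      · rw [max_eq_right (by linarith), abs_of_nonpos (by linarith)]
        ring
  have i1 : Integrable (fun p : ℝ × ℝ => |t - p.2|) π :=
    h.integrable_snd (integrable_abs_sub hμθ.moment_right t)
  have i2 : Integrable (fun p : ℝ × ℝ => |t - p.1|) π :=
    h.integrable_fst (integrable_abs_sub hμθ.moment_left t)
  have i3 : Integrable (fun p : ℝ × ℝ => σ p.1 * (p.2 - p.1)) π :=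
    (h.integrable_increment hμθ.moment_left hμθ.moment_right).bdd_mul (c := 1)
      (hσm.comp measurable_fst).aestronglyMeasurable (ae_of_all _ fun p => hσb p.1)
  have i12 : Integrable (fun p : ℝ × ℝ => |t - p.2| - |t - p.1|) π := i1.sub i2
  have i4 : Integrable (fun p : ℝ × ℝ => taylorKernel p.1 p.2 t) π := by
    simp only [hT]
    exact (i12.sub i3).const_mul _
  rw [← ofReal_integral_eq_lintegral_ofReal i4 (ae_of_all _ fun p => taylorKernel_nonneg _ _ _)]
  have hval : ∫ p, taylorKernel p.1 p.2 t ∂π = 2⁻¹ * (potential θ t - potential μ t) := by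
    simp only [hT]
    rw [integral_const_mul, integral_sub i12 i3, integral_sub i1 i2, h.martingale σ hσm ⟨1, hσb⟩,
      sub_zero, h.integral_snd (g := fun y => |t - y|) (by fun_prop),
      h.integral_fst (g := fun y => |t - y|) (by fun_prop)]
    rfl
  rw [hval, ENNReal.ofReal_mul (by norm_num), ENNReal.ofReal_inv_of_pos (by norm_num),
    ENNReal.ofReal_ofNat]

/-- The upper bound for the distance between a concave function and its tangent. -/
def gap (I J : Set ℝ) (χ : ℝ → ℝ) (p : ℝ × ℝ) : ℝ≥0∞ :=
  ∫⁻ t, ENNReal.ofReal (taylorKernel p.1 p.2 t) ∂(negSecondDeriv I χ) + jumpOn I J χ p.2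

theorem measurable_gap (hI : IsOpen I) (hχ : ConcaveOn ℝ I χ) (hJ : (J \ I).Countable) :
    Measurable (gap I J χ) := by
  have := (negSecondDeriv_spec hI hχ).sigmaFinite hI
  refine Measurable.add ?_ ((measurable_jumpOn hJ).comp measurable_snd)
  exact measurable_taylorKernel.ennreal_ofReal.lintegral_prod_right'

/-- The total gap along a martingale, over the paths that start in `I`. -/
theorem MartingaleCoupling.setLIntegral_gap_le {μ θ : Measure ℝ} {π : Measure (ℝ × ℝ)}
    (h : MartingaleCoupling μ θ π) (hμθ : ConvexOrder μ θ) (hI : IsOpen I)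
    (hχ : ConcaveOn ℝ I χ) (hJ : (J \ I).Countable) :
    ∫⁻ p in Prod.fst ⁻¹' I, gap I J χ p ∂π ≤
      2⁻¹ * ∫⁻ t, ENNReal.ofReal (potential θ t - potential μ t) ∂(negSecondDeriv I χ) +
        ∫⁻ p in Prod.fst ⁻¹' I, jumpOn I J χ p.2 ∂π := by
  have := (negSecondDeriv_spec hI hχ).sigmaFinite hI
  have := hμθ.finite_left
  have := h.isFiniteMeasure
  have hjm : Measurable fun p : ℝ × ℝ => jumpOn I J χ p.2 :=
    (measurable_jumpOn hJ).comp measurable_snd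
  unfold gap
  rw [lintegral_add_right _ hjm]
  gcongr
  calc _ ≤ ∫⁻ p, ∫⁻ t, ENNReal.ofReal (taylorKernel p.1 p.2 t) ∂(negSecondDeriv I χ) ∂π :=
        setLIntegral_le_lintegral _ _
    _ = ∫⁻ t, ∫⁻ p, ENNReal.ofReal (taylorKernel p.1 p.2 t) ∂π ∂(negSecondDeriv I χ) :=
        lintegral_lintegral_swap measurable_taylorKernel.ennreal_ofReal.aemeasurable
    _ = _ := by
        simp only [h.lintegral_taylorKernel hμθ]
        rw [lintegral_const_mul' _ _ (by simp)]

end Gap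

/-! ### Weak duality for real-valued functions. -/

section WeakDuality

variable {I J : Set ℝ} {χ : ℝ → ℝ}

/-- Serves ψ + χ, which is continuous on `I` but may jump at the countably many points of J \ I. -/
theorem measurable_indicator_of_continuousOn {B : ℝ → ℝ} (hI : IsOpen I) (hB : ContinuousOn B I)
    (hIJ : I ⊆ J) (hJ : (J \ I).Countable) : Measurable (J.indicator B) := by
  have h1 : Measurable (I.indicator B) := by
    classical
    rw [← piecewise_eq_indicator]
    exact hB.measurable_piecewise continuousOn_const hI.measurableSet
  refine h1.measurable_of_countable_ne (hJ.mono fun x hx => ?_)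
  by_cases hxI : x ∈ I
  · rw [mem_ofPred_eq, indicator_of_mem hxI, indicator_of_mem (hIJ hxI)] at hx
    exact absurd rfl hx
  · refine ⟨?_, hxI⟩
    by_contra hxJ
    rw [mem_ofPred_eq, indicator_of_notMem hxI, indicator_of_notMem hxJ] at hx
    exact hx rfl

/-- The gap along paths that start in `I`, as a real number. -/
def realGap (I J : Set ℝ) (χ : ℝ → ℝ) (p : ℝ × ℝ) : ℝ :=
  ((Prod.fst ⁻¹' I).indicator (gap I J χ) p).toReal

theorem realGap_nonneg (p : ℝ × ℝ) : 0 ≤ realGap I J χ p := ENNReal.toReal_nonneg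

/-- A finite total gap is finite almost everywhere, so the `[0, ∞]`-valued estimate becomes a
pathwise real inequality with an integrable error. `toReal` alters the gap only on a null set. -/
theorem MartingaleCoupling.realGap_spec {μ θ : Measure ℝ} {π : Measure (ℝ × ℝ)}
    (h : MartingaleCoupling μ θ π) (hI : IsOpen I) (hc : I.OrdConnected) (hIJ : I ⊆ J)
    (hJ : J ⊆ closure I) (hχ : ConcaveOn ℝ J χ) (hθ : ∀ᵐ y ∂θ, y ∈ J)
    (hfin : ∫⁻ p in Prod.fst ⁻¹' I, gap I J χ p ∂π ≠ ⊤) :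
    Integrable (realGap I J χ) π ∧
      ∫ p, realGap I J χ p ∂π = (∫⁻ p in Prod.fst ⁻¹' I, gap I J χ p ∂π).toReal ∧
      ∀ᵐ p ∂π, p.1 ∈ I → χ p.1 ≤ χ p.2 + realGap I J χ p - rightDeriv χ p.1 * (p.2 - p.1) := by
  have hχI : ConcaveOn ℝ I χ := hχ.subset hIJ hc.convex
  have hcount : (J \ I).Countable :=
    (countable_closure_diff hc).mono (sdiff_subset_sdiff_left hJ)
  have hIm : MeasurableSet (Prod.fst ⁻¹' I : Set (ℝ × ℝ)) := measurable_fst hI.measurableSet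
  have hgm : Measurable ((Prod.fst ⁻¹' I).indicator (gap I J χ)) :=
    (measurable_gap hI hχI hcount).indicator hIm
  rw [← lintegral_indicator hIm] at hfin ⊢
  have hlt := ae_lt_top hgm hfin
  refine ⟨integrable_toReal_of_lintegral_ne_top hgm.aemeasurable hfin,
    integral_toReal hgm.aemeasurable hlt, ?_⟩
  filter_upwards [hlt, h.ae_snd hθ] with p hp hpJ hpI
  have h1 := ofReal_tangent_sub_le hI hc hIJ hJ hχ (negSecondDeriv_spec hI hχI) hpI hpJ
  have h2 : (Prod.fst ⁻¹' I).indicator (gap I J χ) p = gap I J χ p :=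
    indicator_of_mem (show p ∈ Prod.fst ⁻¹' I from hpI) _
  have h3 := (ENNReal.ofReal_le_iff_le_toReal (h2 ▸ hp).ne).1 (show _ ≤ gap I J χ p from h1)
  rw [realGap, h2]
  linarith

variable {μ θ ν : Measure ℝ}

/-- The gaps of the two steps `μ → θ → ν` add up to at most the concave integral. -/
theorem Irreducible.lintegral_gap_add_le (h : Irreducible μ ν) (h1 : ConvexOrder μ θ)
    (h2 : ConvexOrder θ ν) {π₁ π₂ : Measure (ℝ × ℝ)} (hπ₁ : MartingaleCoupling μ θ π₁)
    (hπ₂ : MartingaleCoupling θ ν π₂) (hχ : ConcaveOn ℝ (domI μ ν) χ) :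
    ∫⁻ p in Prod.fst ⁻¹' domI μ ν, gap (domI μ ν) (domJ μ ν) χ p ∂π₁ +
      ∫⁻ p in Prod.fst ⁻¹' domI μ ν, gap (domI μ ν) (domJ μ ν) χ p ∂π₂ ≤
      concaveIntegral (domI μ ν) (domJ μ ν) μ ν χ := by
  have hI := h.order.isOpen_domI
  have hcount := h.countable_domJ_diff
  have hm := negSecondDeriv_spec hI hχ
  have hjm : Measurable (jumpOn (domI μ ν) (domJ μ ν) χ) := measurable_jumpOn hcount
  have hIm : MeasurableSet (Prod.fst ⁻¹' domI μ ν : Set (ℝ × ℝ)) :=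
    measurable_fst hI.measurableSet
  have hstay := hπ₂.ae_eq_of_notMem h2.moment_left h2.moment_right h.ordConnected h.ae_mem_closure
  have cont : ∀ {ρ : Measure ℝ}, IsFiniteMeasure ρ → Integrable (fun x : ℝ => x) ρ →
      Continuous (potential ρ) := fun _ hρ => continuous_potential hρ
  have cμ := cont h1.finite_left h1.moment_left
  have cθ := cont h1.finite_right h1.moment_right
  -- Paths of the second step that start outside `I` stay put. So the jumps seen by `ν` are those
  -- already seen by `θ` plus those reached by paths from `I`.
  have hjump : ∫⁻ p in Prod.fst ⁻¹' domI μ ν, jumpOn (domI μ ν) (domJ μ ν) χ p.2 ∂π₂ +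
      ∫⁻ x, jumpOn (domI μ ν) (domJ μ ν) χ x ∂θ =
      ∫⁻ x, jumpOn (domI μ ν) (domJ μ ν) χ x ∂ν := by
    rw [← hπ₂.lintegral_snd hjm, ← hπ₂.lintegral_fst hjm, ← lintegral_add_compl (μ := π₂)
      (fun p => jumpOn (domI μ ν) (domJ μ ν) χ p.2) hIm]
    congr 1
    rw [← lintegral_indicator hIm.compl]
    refine lintegral_congr_ae ?_
    filter_upwards [hstay] with p hp
    by_cases hpI : p.1 ∈ domI μ ν
    · rw [indicator_of_notMem (show p ∉ (Prod.fst ⁻¹' domI μ ν)ᶜ from fun hn => hn hpI), jumpOn,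
        indicator_of_notMem (show p.1 ∉ domJ μ ν \ domI μ ν from fun hn => hn.2 hpI)]
    · rw [indicator_of_mem (show p ∈ (Prod.fst ⁻¹' domI μ ν)ᶜ from hpI), hp hpI]
  have hμ0 : ∫⁻ x in domJ μ ν \ domI μ ν, ENNReal.ofReal (jump (domI μ ν) χ x) ∂μ = 0 :=
    setLIntegral_measure_zero _ _
      (measure_mono_null (fun x hx => hx.2) (ae_iff.1 h.ae_mem_domI))
  have hm0 : (negSecondDeriv (domI μ ν) χ).restrict (domI μ ν) = negSecondDeriv (domI μ ν) χ :=
    Measure.restrict_eq_self_of_ae_mem hm.1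
  have hmJ : MeasurableSet (domJ μ ν \ domI μ ν) := hcount.measurableSet
  have hpot : ∫⁻ t, ENNReal.ofReal (potential ν t - potential μ t) ∂(negSecondDeriv (domI μ ν) χ) =
      ∫⁻ t, ENNReal.ofReal (potential θ t - potential μ t) ∂(negSecondDeriv (domI μ ν) χ) +
      ∫⁻ t, ENNReal.ofReal (potential ν t - potential θ t) ∂(negSecondDeriv (domI μ ν) χ) := by
    rw [← lintegral_add_left (by fun_prop)]
    refine lintegral_congr fun t => ?_
    rw [← ENNReal.ofReal_add (sub_nonneg.2 (h1.potential_le t)) (sub_nonneg.2 (h2.potential_le t))]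
    congr 1
    ring
  rw [concaveIntegral, hm0, hμ0, tsub_zero, hpot, ← lintegral_indicator hmJ]
  have e1 := hπ₁.setLIntegral_gap_le (J := domJ μ ν) h1 hI hχ hcount
  have e2 := hπ₂.setLIntegral_gap_le (J := domJ μ ν) h2 hI hχ hcount
  have e3 : ∫⁻ p in Prod.fst ⁻¹' domI μ ν, jumpOn (domI μ ν) (domJ μ ν) χ p.2 ∂π₁ ≤
      ∫⁻ x, jumpOn (domI μ ν) (domJ μ ν) χ x ∂θ := by
    rw [← hπ₁.lintegral_snd hjm]
    exact setLIntegral_le_lintegral _ _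
  refine (add_le_add (e1.trans (add_le_add_right e3 _)) e2).trans ?_
  change _ ≤ _ + ∫⁻ x, jumpOn (domI μ ν) (domJ μ ν) χ x ∂ν
  rw [← hjump, mul_add]
  refine le_of_eq ?_
  ring

/-- Weak duality for real-valued functions. -/
theorem Irreducible.integral_le_of_moderator (h : Irreducible μ ν) (h1 : ConvexOrder μ θ)
    (h2 : ConvexOrder θ ν) {φ ψ f : ℝ → ℝ} (hφ : ConcaveOn ℝ (domJ μ ν) φ)
    (hψ : ConvexOn ℝ (domJ μ ν) ψ) (hχ : ConcaveOn ℝ (domJ μ ν) χ)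
    (hA : Integrable (fun x => φ x - χ x) μ) (hB : Integrable (fun x => ψ x + χ x) ν)
    (hfin : concaveIntegral (domI μ ν) (domJ μ ν) μ ν χ ≠ ⊤) (hf : Integrable f θ)
    (hf0 : ∀ x, 0 ≤ f x) (hle : ∀ x ∈ domJ μ ν, f x ≤ φ x + ψ x) :
    ∫ x, f x ∂θ ≤ ∫ x, (φ x - χ x) ∂μ + ∫ x, (ψ x + χ x) ∂ν +
      (concaveIntegral (domI μ ν) (domJ μ ν) μ ν χ).toReal := by
  obtain ⟨π₁, hπ₁⟩ := h1.exists_martingaleCoupling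
  obtain ⟨π₂, hπ₂⟩ := h2.exists_martingaleCoupling
  set I := domI μ ν with hIdef
  set J := domJ μ ν with hJdef
  have hI : IsOpen I := h.order.isOpen_domI
  have hc : I.OrdConnected := h.ordConnected
  have hIJ : I ⊆ J := domI_subset_domJ
  have hJ : J ⊆ closure I := domJ_subset_closure
  have hJm : MeasurableSet J := h.measurableSet_domJ
  have hχI : ConcaveOn ℝ I χ := hχ.subset hIJ hc.convex
  have hψI : ConvexOn ℝ I ψ := hψ.subset hIJ hc.convex
  have hstay := hπ₂.ae_eq_of_notMem h2.moment_left h2.moment_right hc h.ae_mem_closure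
  have hνJ : ∀ᵐ y ∂ν, y ∈ J := h.ae_mem_domJ
  -- A path of the second step either starts in `I` or never moves and ends in `J`.
  have hθJ : ∀ᵐ y ∂θ, y ∈ J := by
    rw [← hπ₂.fst]
    refine (ae_map_iff (p := fun y => y ∈ J) measurable_fst.aemeasurable hJm).2 ?_
    filter_upwards [hstay, hπ₂.ae_snd hνJ] with p hp hpJ
    by_cases hpI : p.1 ∈ I
    · exact hIJ hpI
    · exact hp hpI ▸ hpJ
  have hgap := h.lintegral_gap_add_le h1 h2 hπ₁ hπ₂ hχI
  have hfin' := ne_top_of_le_ne_top hfin hgap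
  obtain ⟨hg1, hg1', hg1''⟩ := hπ₁.realGap_spec hI hc hIJ hJ hχ hθJ (ENNReal.add_ne_top.1 hfin').1
  obtain ⟨hg2, hg2', hg2''⟩ := hπ₂.realGap_spec hI hc hIJ hJ hχ hνJ (ENNReal.add_ne_top.1 hfin').2
  set B : ℝ → ℝ := J.indicator fun x => ψ x + χ x with hBdef
  have hBm : Measurable B := measurable_indicator_of_continuousOn hI
    ((hψI.continuousOn hI).add (hχI.continuousOn hI)) hIJ h.countable_domJ_diff
  have hBJ : ∀ x ∈ J, B x = ψ x + χ x := fun x hx => indicator_of_mem hx _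
  have hBν : (fun x => ψ x + χ x) =ᵐ[ν] B := hνJ.mono fun x hx => (hBJ x hx).symm
  have hBi : Integrable B ν := hB.congr hBν
  rw [integral_congr_ae hBν]
  -- second step: from `θ` to `ν`
  set N₂ : ℝ × ℝ → ℝ := fun p => B p.2 + realGap I J χ p with hN₂
  have hN₂i : Integrable N₂ π₂ := (hπ₂.integrable_snd hBi).add hg2
  set k₂ : ℝ → ℝ := I.indicator fun y => rightDeriv (-ψ) y - rightDeriv χ y with hk₂
  have hk₂m : Measurable k₂ :=
    ((measurable_rightDeriv _).sub (measurable_rightDeriv _)).indicator hI.measurableSet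
  have hstep₂ : ∀ᵐ p ∂π₂, B p.1 ≤ N₂ p + k₂ p.1 * (p.2 - p.1) := by
    filter_upwards [hstay, hπ₂.ae_snd hνJ, hg2''] with p hp hpJ hg
    by_cases hpI : p.1 ∈ I
    · have e1 := le_tangent hI hIJ hψ.neg hpI hpJ
      have e2 := hg hpI
      rw [hN₂, hk₂]
      dsimp only
      rw [hBJ _ (hIJ hpI), hBJ _ hpJ, indicator_of_mem hpI]
      simp only [Pi.neg_apply] at e1
      linarith
    · rw [hN₂, hk₂]
      dsimp only
      rw [indicator_of_notMem hpI, hp hpI, zero_mul, add_zero]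
      exact le_add_of_nonneg_right (realGap_nonneg p)
  -- Integrability of `B` under `θ` is not known yet. Trading only where B > 0 allows the lower
  -- bound 0 and yields that of B⁺. Since f ≥ 0, -B⁺ then serves as lower bound for f - B in the
  -- first step.
  have hBpos : Integrable (fun x => max (B x) 0) θ := by
    have hE : MeasurableSet {y | 0 < B y} := measurableSet_lt measurable_const hBm
    have := (hπ₂.integral_le_of_le_add_increment h2.moment_left h2.moment_right
      (N := fun p => |N₂ p|) (G := fun p => max (B p.1) 0) (G₀ := fun _ => 0)
      (k := {y | 0 < B y}.indicator k₂) hN₂i.abs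
      ((hBm.max measurable_const).comp measurable_fst).aestronglyMeasurable
      (integrable_zero _ _ _) (hk₂m.indicator hE) (ae_of_all _ fun p => le_max_right _ _) (by
        filter_upwards [hstep₂] with p hp
        by_cases hpB : 0 < B p.1
        · rw [indicator_of_mem (show p.1 ∈ {y | 0 < B y} from hpB), max_eq_left hpB.le]
          exact hp.trans (add_le_add_left (le_abs_self _) _)
        · rw [indicator_of_notMem (show p.1 ∉ {y | 0 < B y} from hpB),
            max_eq_right (not_lt.1 hpB), zero_mul, add_zero]
          exact abs_nonneg _)).1
    rw [← hπ₂.fst]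
    exact (integrable_map_measure (hBm.max measurable_const).aestronglyMeasurable
      measurable_fst.aemeasurable).2 this
  -- first step: from `μ` to `θ`
  have hfB : AEStronglyMeasurable (fun x => f x - B x) θ := hf.1.sub hBm.aestronglyMeasurable
  have hfB2 : AEStronglyMeasurable (fun p : ℝ × ℝ => f p.2 - B p.2) π₁ := by
    rw [← hπ₁.snd] at hfB
    exact hfB.comp_measurable measurable_snd
  have hN₁i : Integrable (fun p : ℝ × ℝ => φ p.1 - χ p.1 + realGap I J χ p) π₁ :=
    (hπ₁.integrable_fst hA).add hg1
  obtain ⟨hGi, hGle⟩ := hπ₁.integral_le_of_le_add_increment h1.moment_left h1.moment_right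
    (N := fun p => φ p.1 - χ p.1 + realGap I J χ p) (G := fun p => f p.2 - B p.2)
    (G₀ := fun p => -max (B p.2) 0) (k := fun x => rightDeriv φ x - rightDeriv χ x) hN₁i hfB2
    (hπ₁.integrable_snd hBpos).neg ((measurable_rightDeriv _).sub (measurable_rightDeriv _))
    (ae_of_all _ fun p => by
      have := le_max_left (B p.2) 0
      have := hf0 p.2
      linarith)
    (by
      filter_upwards [hπ₁.ae_fst h.ae_mem_domI, hπ₁.ae_snd hθJ, hg1''] with p hpI hpJ hg
      have e1 := le_tangent hI hIJ hφ hpI hpJ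
      have e2 := hg hpI
      have e3 := hle _ hpJ
      rw [hBJ _ hpJ]
      linarith)
  have hfBi : Integrable (fun x => f x - B x) θ := by
    rw [← hπ₁.snd]
    rw [← hπ₁.snd] at hfB
    exact (integrable_map_measure hfB measurable_snd.aemeasurable).2 hGi
  -- Now `B` itself can be its own lower bound, and the second step is integrated in full.
  have hBθ : Integrable B θ := (hf.sub hfBi).congr (ae_of_all _ fun x => by simp)
  have hBle := (hπ₂.integral_le_of_le_add_increment h2.moment_left h2.moment_right
    (G := fun p => B p.1) (G₀ := fun p => B p.1) hN₂i (hπ₂.integrable_fst hBθ).1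
    (hπ₂.integrable_fst hBθ) hk₂m (ae_of_all _ fun p => le_rfl) hstep₂).2
  rw [hπ₂.integral_fst hBθ.1, hN₂, integral_add (hπ₂.integrable_snd hBi) hg2,
    hπ₂.integral_snd hBi.1, hg2'] at hBle
  rw [hπ₁.integral_snd (g := fun x => f x - B x) hfB, integral_sub hf hBθ,
    integral_add (hπ₁.integrable_fst hA) hg1, hπ₁.integral_fst (g := fun x => φ x - χ x) hA.1,
    hg1'] at hGle
  have hsum := ENNReal.toReal_mono hfin hgap
  rw [ENNReal.toReal_add (ENNReal.add_ne_top.1 hfin').1 (ENNReal.add_ne_top.1 hfin').2] at hsum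
  linarith

end WeakDuality

/-! ### Concave and convex functions with infinite values. -/

section ExtendedReal

variable {J : Set ℝ} {φ ψ : ℝ → EReal}

theorem ConcaveOnE.concaveOn_toReal (h : ConcaveOnE J φ) (hJ : Convex ℝ J)
    (hbot : ∀ x ∈ J, φ x ≠ ⊥) (htop : ∀ x ∈ J, φ x ≠ ⊤) :
    ConcaveOn ℝ J fun x => (φ x).toReal := by
  refine ⟨hJ, fun x hx y hy a b ha hb hab => ?_⟩
  have h1 := h (x := (x, (φ x).toReal)) ⟨hx, (EReal.coe_toReal (htop x hx) (hbot x hx)).le⟩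
    (y := (y, (φ y).toReal)) ⟨hy, (EReal.coe_toReal (htop y hy) (hbot y hy)).le⟩ ha hb hab
  have hz := hJ hx hy ha hb hab
  rw [← EReal.coe_le_coe_iff, EReal.coe_toReal (htop _ hz) (hbot _ hz)]
  exact h1.2

theorem ConvexOnE.convexOn_toReal (h : ConvexOnE J ψ) (hJ : Convex ℝ J)
    (hbot : ∀ x ∈ J, ψ x ≠ ⊥) (htop : ∀ x ∈ J, ψ x ≠ ⊤) :
    ConvexOn ℝ J fun x => (ψ x).toReal := by
  refine ⟨hJ, fun x hx y hy a b ha hb hab => ?_⟩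
  have h1 := h (x := (x, (ψ x).toReal)) ⟨hx, (EReal.coe_toReal (htop x hx) (hbot x hx)).ge⟩
    (y := (y, (ψ y).toReal)) ⟨hy, (EReal.coe_toReal (htop y hy) (hbot y hy)).ge⟩ ha hb hab
  have hz := hJ hx hy ha hb hab
  rw [← EReal.coe_le_coe_iff, EReal.coe_toReal (htop _ hz) (hbot _ hz)]
  exact h1.2

/-- A concave function above `-∞` that takes the value `∞` is infinite inside its domain. -/
theorem ConcaveOnE.eq_top (h : ConcaveOnE J φ) (hbot : ∀ x ∈ J, φ x ≠ ⊥) {I : Set ℝ}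
    (hI : IsOpen I) (hIJ : I ⊆ J) {x₀ : ℝ} (hx₀ : x₀ ∈ J) (htop : φ x₀ = ⊤) {x : ℝ} (hx : x ∈ I) :
    φ x = ⊤ := by
  have hcont : Tendsto (fun s : ℝ => x + s * (x - x₀)) (𝓝[>] 0) (𝓝 x) := by
    have : Tendsto (fun s : ℝ => x + s * (x - x₀)) (𝓝 0) (𝓝 (x + 0 * (x - x₀))) :=
      Continuous.tendsto (by fun_prop) 0
    rw [zero_mul, add_zero] at this
    exact this.mono_left nhdsWithin_le_nhds
  obtain ⟨s, hsI, hs : 0 < s⟩ :=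
    ((hcont.eventually (hI.mem_nhds hx)).and self_mem_nhdsWithin).exists
  obtain ⟨r, -, hr⟩ := EReal.lt_iff_exists_real_btwn.1 (bot_lt_iff_ne_bot.2 (hbot _ (hIJ hsI)))
  rw [EReal.eq_top_iff_forall_lt]
  intro M
  -- `x` lies between `x₀` and x + s(x - x₀), with weights s/(1 + s) and 1/(1 + s). The height over
  -- `x₀` is chosen so that the combination has height M + 1.
  have h1 := h (x := (x₀, ((1 + s) * (M + 1) - r) / s)) ⟨hx₀, htop ▸ le_top⟩
    (y := (x + s * (x - x₀), r)) ⟨hIJ hsI, hr.le⟩ (a := s / (1 + s)) (b := 1 / (1 + s))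
    (by positivity) (by positivity) (by field_simp; ring)
  have e1 : s / (1 + s) * x₀ + 1 / (1 + s) * (x + s * (x - x₀)) = x := by
    field_simp
    ring
  have e2 : s / (1 + s) * (((1 + s) * (M + 1) - r) / s) + 1 / (1 + s) * r = M + 1 := by
    field_simp
    ring
  have h2 := h1.2
  simp only [Prod.fst_add, Prod.snd_add, Prod.smul_fst, Prod.smul_snd, smul_eq_mul] at h2
  rw [e1, e2] at h2
  exact lt_of_lt_of_le (EReal.coe_lt_coe_iff.2 (by linarith)) h2

theorem ConvexOnE.ne_top_of_between (h : ConvexOnE J ψ) {x y z : ℝ} (hx : x ∈ J) (hy : y ∈ J)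
    (hψx : ψ x ≠ ⊤) (hψy : ψ y ≠ ⊤) (hxz : x ≤ z) (hzy : z ≤ y) : ψ z ≠ ⊤ := by
  obtain ⟨r, hr, -⟩ := EReal.lt_iff_exists_real_btwn.1 (lt_top_iff_ne_top.2 hψx)
  obtain ⟨s, hs, -⟩ := EReal.lt_iff_exists_real_btwn.1 (lt_top_iff_ne_top.2 hψy)
  have hz : z ∈ segment ℝ x y := by
    rw [segment_eq_Icc (hxz.trans hzy)]
    exact ⟨hxz, hzy⟩
  obtain ⟨a, b, ha, hb, hab, rfl⟩ := hz
  have h1 := h (x := (x, r)) ⟨hx, hr.le⟩ (y := (y, s)) ⟨hy, hs.le⟩ ha hb hab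
  exact ne_top_of_le_ne_top (EReal.coe_ne_top _) h1.2

end ExtendedReal

/-! ### Admissible pairs: finiteness, weak duality, and the upper bound for the dual value. -/

section Admissible

variable {μ ν : Measure ℝ}

/-- `ν` charges both sides of every point of `I`. -/
theorem Irreducible.not_ae_of_mem_domI (h : Irreducible μ ν) {x : ℝ} (hx : x ∈ domI μ ν) (s : ℝ)
    (hs : |s| = 1) : ¬ ∀ᵐ y ∂ν, 0 ≤ s * (x - y) := by
  intro hae
  have := h.order.finite_left
  have := h.order.finite_right
  -- If `ν` lies on one side of `x`, its potential there is an affine integral. That integral is the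
  -- same for `μ` and at most `potential μ x`, which contradicts x ∈ I.
  have e1 : potential ν x = ∫ y, (-s * y + s * x) ∂ν := by
    refine integral_congr_ae ?_
    filter_upwards [hae] with y hy
    rw [← one_mul |x - y|, ← hs, ← abs_mul, abs_of_nonneg hy]
    ring
  have e2 : ∫ y, (-s * y + s * x) ∂μ ≤ potential μ x := by
    refine integral_mono ((h.order.moment_left.const_mul _).add (integrable_const _))
      (integrable_abs_sub h.order.moment_left x) fun y => ?_
    have : -s * y + s * x = s * (x - y) := by ring
    dsimp only
    rw [this]
    refine (le_abs_self _).trans ?_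
    rw [abs_mul, hs, one_mul]
  rw [h.order.integral_affine_eq, ← e1] at e2
  exact absurd hx (not_lt.2 e2)

theorem Irreducible.measure_ne_zero (h : Irreducible μ ν) (hne : (domI μ ν).Nonempty) : μ ≠ 0 := by
  rintro rfl
  obtain ⟨x, hx⟩ := hne
  have h0 := h.order.measure_univ_eq
  rw [Measure.coe_zero, Pi.zero_apply, eq_comm, Measure.measure_univ_eq_zero] at h0
  subst h0
  exact lt_irrefl (potential 0 x) hx

/-- In `EReal` the value ⊥ absorbs every summand, also ⊤, so a nonnegative sum excludes it on both
sides. -/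
theorem ne_bot_of_le_add {a : ℝ≥0∞} {b c : EReal} (h : (a : EReal) ≤ b + c) : b ≠ ⊥ ∧ c ≠ ⊥ := by
  have h0 : (0 : EReal) ≤ b + c := (EReal.coe_ennreal_nonneg a).trans h
  constructor
  · rintro rfl
    rw [EReal.bot_add] at h0
    exact absurd h0 (not_le.2 EReal.bot_lt_zero)
  · rintro rfl
    rw [EReal.add_bot] at h0
    exact absurd h0 (not_le.2 EReal.bot_lt_zero)

variable {f : ℝ → ℝ≥0∞} {φ ψ : ℝ → EReal} {χ : ℝ → ℝ}

/-- A single infinite value would force φ = ∞ on all of `I`. This set carries the nonzero measure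
`μ`, against the integrability of φ - χ. -/
theorem DualAdmissible.left_ne_top (h : Irreducible μ ν) (hd : DualAdmissible μ ν f φ ψ) :
    ∀ x ∈ domJ μ ν, φ x ≠ ⊤ := by
  intro x₀ hx₀ htop
  have hne : (domI μ ν).Nonempty := closure_nonempty_iff.1 ⟨x₀, domJ_subset_closure hx₀⟩
  have hμ : NeBot (ae μ) := ae_neBot.2 (h.measure_ne_zero hne)
  obtain ⟨χ, hχ, -⟩ := hd.memLc.exists_moderator
  have h1 := hχ.integrable_left.1
  rw [ae_restrict_iff' h.measurableSet_domJ] at h1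
  obtain ⟨x, hx, hxI⟩ := (h1.and h.ae_mem_domI).exists
  have h2 := hd.concave.eq_top (fun x hx => (ne_bot_of_le_add (hd.superhedge x hx)).1)
    h.order.isOpen_domI domI_subset_domJ hx₀ htop hxI
  refine (hx (domI_subset_domJ hxI)).1 ?_
  dsimp only
  rw [h2, EReal.top_sub_coe]

/-- ψ is finite `ν`-almost everywhere. Each point of `I` has `ν`-mass on both sides, so convexity
gives finiteness there; the endpoints in `J` are atoms of `ν`. -/
theorem DualAdmissible.right_ne_top (h : Irreducible μ ν) (hd : DualAdmissible μ ν f φ ψ) :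
    ∀ x ∈ domJ μ ν, ψ x ≠ ⊤ := by
  obtain ⟨χ, hχ, -⟩ := hd.memLc.exists_moderator
  have hae : ∀ᵐ x ∂ν, x ∈ domJ μ ν ∧ ψ x ≠ ⊤ := by
    have h1 := hχ.integrable_right.1
    rw [ae_restrict_iff' h.measurableSet_domJ] at h1
    filter_upwards [h1, h.ae_mem_domJ] with x hx hxJ
    refine ⟨hxJ, fun htop => (hx hxJ).1 ?_⟩
    rw [htop, EReal.top_add_coe]
  rintro x (hx | ⟨-, hx⟩)
  · have hside : ∀ s : ℝ, |s| = 1 → ∃ y, (y ∈ domJ μ ν ∧ ψ y ≠ ⊤) ∧ s * (x - y) < 0 := by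
      intro s hs
      by_contra! hcon
      exact h.not_ae_of_mem_domI hx s hs (hae.mono hcon)
    obtain ⟨y, hy, hxy⟩ := hside 1 (by simp)
    obtain ⟨z, hz, hxz⟩ := hside (-1) (by simp)
    exact hd.convex.ne_top_of_between hz.1 hy.1 hz.2 hy.2 (by linarith) (by linarith)
  · by_contra htop
    refine hx (measure_mono_null (fun y hy => ?_) (ae_iff.1 hae))
    rw [mem_singleton_iff] at hy
    subst hy
    exact fun hn => hn.2 htop

/-- Weak duality. -/
theorem Irreducible.outerIntegral_le_moderatedValue (h : Irreducible μ ν) {θ : Measure ℝ}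
    (h1 : ConvexOrder μ θ) (h2 : ConvexOrder θ ν) {C : ℝ≥0} (hfC : ∀ x, f x ≤ C)
    (hf : Measurable f) (hd : DualAdmissible μ ν f φ ψ)
    (hχ : IsModerator (domJ μ ν) μ ν φ ψ χ) :
    ((outerIntegral θ f : ℝ≥0∞) : EReal) ≤
      moderatedValue (domI μ ν) (domJ μ ν) μ ν φ ψ χ := by
  -- `generalizedIntegral` is an infimum over all moderators, including those of infinite concave
  -- integral.
  by_cases hfin : concaveIntegral (domI μ ν) (domJ μ ν) μ ν χ = ⊤
  · rw [moderatedValue, hfin, ← EReal.coe_add, EReal.coe_ennreal_top, EReal.coe_add_top]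
    exact le_top
  have := h1.finite_right
  have hJm := h.measurableSet_domJ
  have hJc : Convex ℝ (domJ μ ν) := hχ.concave.1
  have hφb : ∀ x ∈ domJ μ ν, φ x ≠ ⊥ := fun x hx => (ne_bot_of_le_add (hd.superhedge x hx)).1
  have hψb : ∀ x ∈ domJ μ ν, ψ x ≠ ⊥ := fun x hx => (ne_bot_of_le_add (hd.superhedge x hx)).2
  have hφt := hd.left_ne_top h
  have hψt := hd.right_ne_top h
  have hfx : ∀ x, f x ≠ ⊤ := fun x => ne_top_of_le_ne_top ENNReal.coe_ne_top (hfC x)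
  have hμr : μ.restrict (domJ μ ν) = μ := Measure.restrict_eq_self_of_ae_mem
    (h.ae_mem_domI.mono fun x hx => domI_subset_domJ hx)
  have hνr : ν.restrict (domJ μ ν) = ν := Measure.restrict_eq_self_of_ae_mem h.ae_mem_domJ
  have hA : (fun x => (φ x - (χ x : EReal)).toReal) =ᵐ[μ] fun x => (φ x).toReal - χ x := by
    filter_upwards [h.ae_mem_domI] with x hx
    have hxJ := domI_subset_domJ hx
    rw [EReal.toReal_sub (hφt x hxJ) (hφb x hxJ) (EReal.coe_ne_top _) (EReal.coe_ne_bot _),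
      EReal.toReal_coe]
  have hB : (fun x => (ψ x + (χ x : EReal)).toReal) =ᵐ[ν] fun x => (ψ x).toReal + χ x := by
    filter_upwards [h.ae_mem_domJ] with x hxJ
    rw [EReal.toReal_add (hψt x hxJ) (hψb x hxJ) (EReal.coe_ne_top _) (EReal.coe_ne_bot _),
      EReal.toReal_coe]
  have hAi := hχ.integrable_left.2
  have hBi := hχ.integrable_right.2
  rw [IntegrableOn, hμr] at hAi
  rw [IntegrableOn, hνr] at hBi
  have hfi : Integrable (fun x => (f x).toReal) θ := by
    refine (integrable_const (C : ℝ)).mono' hf.ennreal_toReal.aestronglyMeasurable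
      (ae_of_all _ fun x => ?_)
    rw [Real.norm_of_nonneg ENNReal.toReal_nonneg]
    exact ENNReal.toReal_le_coe_of_le_coe (hfC x)
  have key := h.integral_le_of_moderator h1 h2 (hd.concave.concaveOn_toReal hJc hφb hφt)
    (hd.convex.convexOn_toReal hJc hψb hψt) hχ.concave (hAi.congr hA) (hBi.congr hB) hfin hfi
    (fun x => ENNReal.toReal_nonneg) (fun x hx => by
      have := hd.superhedge x hx
      rw [← EReal.coe_ennreal_toReal (hfx x), ← EReal.coe_toReal (hφt x hx) (hφb x hx),
        ← EReal.coe_toReal (hψt x hx) (hψb x hx), ← EReal.coe_add, EReal.coe_le_coe_iff] at this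
      exact this)
  rw [moderatedValue, hμr, hνr, integral_congr_ae hA, integral_congr_ae hB,
    ← EReal.coe_ennreal_toReal hfin, outerIntegral_eq_lintegral _ hf, ← EReal.coe_add,
    ← EReal.coe_add]
  rw [integral_toReal hf.aemeasurable (ae_of_all _ fun x => lt_top_iff_ne_top.2 (hfx x))] at key
  have hne : ∫⁻ x, f x ∂θ ≠ ⊤ := by
    refine ((lintegral_mono hfC).trans_lt ?_).ne
    rw [lintegral_const]
    exact ENNReal.mul_lt_top ENNReal.coe_lt_top (measure_lt_top _ _)
  rw [← EReal.coe_ennreal_toReal hne, EReal.coe_le_coe_iff]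
  exact key

theorem concaveIntegral_zero (h : Irreducible μ ν) :
    concaveIntegral (domI μ ν) (domJ μ ν) μ ν (fun _ => 0) = 0 := by
  have hI := h.order.isOpen_domI
  have hχ : ConcaveOn ℝ (domI μ ν) (fun _ => (0 : ℝ)) := concaveOn_const _ h.ordConnected.convex
  have hm : negSecondDeriv (domI μ ν) (fun _ => 0) = 0 := by
    refine (negSecondDeriv_spec hI hχ).unique hI ⟨by simp, fun a _ b _ _ => ?_⟩ h.ordConnected
    simp [rightDeriv]
  have hj : ∀ ρ : Measure ℝ, ∫⁻ x in domJ μ ν \ domI μ ν,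
      ENNReal.ofReal (jump (domI μ ν) (fun _ => 0) x) ∂ρ = 0 := fun ρ => by
    rw [setLIntegral_congr_fun (g := fun _ => 0) h.countable_domJ_diff.measurableSet,
      lintegral_zero]
    intro x hx
    have : (𝓝[domI μ ν] x).NeBot :=
      mem_closure_iff_nhdsWithin_neBot.1 (domJ_subset_closure hx.1)
    dsimp only
    rw [jump, tendsto_const_nhds.limUnder_eq, sub_zero, abs_zero, ENNReal.ofReal_zero]
  rw [concaveIntegral, hm, hj, hj]
  simp

/-- Functions of linear growth on `ℝ` bound the dual value. -/
theorem Irreducible.auxDual_le (h : Irreducible μ ν) (hfx : ∀ x, f x ≠ ⊤) {φ ψ : ℝ → ℝ}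
    (hφ : ConcaveOn ℝ univ φ) (hψ : ConvexOn ℝ univ ψ) (hφg : φ ∈ growthSpace linearWeight)
    (hψg : ψ ∈ growthSpace linearWeight) (hle : ∀ x, (f x).toReal ≤ φ x + ψ x) :
    auxDual μ ν f ≤ ((∫ x, φ x ∂μ + ∫ x, ψ x ∂ν : ℝ) : EReal) := by
  have := h.order.finite_left
  have := h.order.finite_right
  have hJc : Convex ℝ (domJ μ ν) := (ordConnected_of_subset_closure h.ordConnected
    domI_subset_domJ domJ_subset_closure).convex
  have hμr : μ.restrict (domJ μ ν) = μ := Measure.restrict_eq_self_of_ae_mem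
    (h.ae_mem_domI.mono fun x hx => domI_subset_domJ hx)
  have hνr : ν.restrict (domJ μ ν) = ν := Measure.restrict_eq_self_of_ae_mem h.ae_mem_domJ
  have hφc := hφ.continuous_of_univ
  have hψc := hψ.continuous_of_univ
  have e1 : ∀ x, (φ x : EReal) - ((0 : ℝ) : EReal) = φ x := fun x => by simp
  have e2 : ∀ x, (ψ x : EReal) + ((0 : ℝ) : EReal) = ψ x := fun x => by simp
  -- Linear growth makes both functions integrable, so the zero moderator works and the generalized
  -- integral is at most the ordinary sum.
  have hmod : IsModerator (domJ μ ν) μ ν (fun x => (φ x : EReal)) (fun x => (ψ x : EReal))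
      (fun _ => 0) := by
    refine ⟨concaveOn_const _ hJc, ⟨ae_of_all _ fun x => ?_, ?_⟩, ⟨ae_of_all _ fun x => ?_, ?_⟩⟩
    · dsimp only
      rw [e1]
      exact ⟨EReal.coe_ne_top _, EReal.coe_ne_bot _⟩
    · simp only [e1, EReal.toReal_coe]
      exact (integrable_of_mem_growthSpace (integrable_linearWeight h.order.moment_left) hφg
        hφc).integrableOn
    · dsimp only
      rw [e2]
      exact ⟨EReal.coe_ne_top _, EReal.coe_ne_bot _⟩
    · simp only [e2, EReal.toReal_coe]
      exact (integrable_of_mem_growthSpace (integrable_linearWeight h.order.moment_right) hψg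
        hψc).integrableOn
  have hadm : DualAdmissible μ ν f (fun x => (φ x : EReal)) (fun x => (ψ x : EReal)) := by
    refine ⟨⟨?_, ?_, _, hmod, ?_⟩, ?_, ?_, fun x _ => ?_⟩
    · exact (measurable_coe_real_ereal.comp hφc.measurable).comp measurable_subtype_coe
    · exact (measurable_coe_real_ereal.comp hψc.measurable).comp measurable_subtype_coe
    · rw [concaveIntegral_zero h]
      exact ENNReal.zero_lt_top
    · simpa only [ConcaveOnE, EReal.coe_le_coe_iff] using
        (hφ.subset (subset_univ _) hJc).convex_hypograph
    · simpa only [ConvexOnE, EReal.coe_le_coe_iff] using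
        (hψ.subset (subset_univ _) hJc).convex_epigraph
    · rw [← EReal.coe_ennreal_toReal (hfx x), ← EReal.coe_add, EReal.coe_le_coe_iff]
      exact hle x
  refine iInf_le_of_le _ (iInf_le_of_le _ (iInf_le_of_le hadm ?_))
  refine iInf_le_of_le _ (iInf_le_of_le hmod (le_of_eq ?_))
  rw [moderatedValue, concaveIntegral_zero h, hμr, hνr]
  simp only [e1, e2, EReal.toReal_coe, EReal.coe_ennreal_zero, add_zero, EReal.coe_add]

end Admissible

end ConvexOrderDuality

end

/-! ### The duality theorem. -/

theorem mainTheorem6 (μ ν : MeasureTheory.Measure ℝ) (hμν : ConvexOrderDuality.Irreducible μ ν)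
    (f : ℝ → ℝ≥0∞) (hf_bdd : ∃ C : ℝ≥0, ∀ x, f x ≤ (C : ℝ≥0∞)) (hf_usc : UpperSemicontinuous f) :
    ((ConvexOrderDuality.auxPrimal μ ν f : ℝ≥0∞) : EReal) = ConvexOrderDuality.auxDual μ ν f := by
  obtain ⟨C, hC⟩ := hf_bdd
  have hfm : Measurable f := hf_usc.measurable
  have hfx : ∀ x, f x ≠ ⊤ := fun x => ne_top_of_le_ne_top ENNReal.coe_ne_top (hC x)
  refine le_antisymm ?_ ?_
  · refine le_iInf fun φ => le_iInf fun ψ => le_iInf fun hd => le_iInf fun χ => le_iInf fun hχ => ?_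
    have hle := fun θ h1 h2 =>
      hμν.outerIntegral_le_moderatedValue (θ := θ) (χ := χ) h1 h2 hC hfm hd hχ
    -- The choice θ = μ shows that the dual value is nonnegative, so the supremum can be bounded in
    -- `[0, ∞]`.
    have hrefl : ConvexOrderDuality.ConvexOrder μ μ :=
      ⟨hμν.order.finite_left, hμν.order.finite_left, hμν.order.moment_left, hμν.order.moment_left,
        fun _ _ => le_rfl⟩
    have h0 := (EReal.coe_ennreal_nonneg _).trans (hle μ hrefl hμν.order)
    rw [← EReal.coe_toENNReal h0, EReal.coe_ennreal_le_coe_ennreal_iff]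
    refine iSup_le fun θ => iSup_le fun h1 => iSup_le fun h2 => ?_
    rw [← EReal.coe_ennreal_le_coe_ennreal_iff, EReal.coe_toENNReal h0]
    exact hle θ h1 h2
  · have husc : UpperSemicontinuous fun x => (f x).toReal := by
      intro x y hxy
      have h1 : f x < ENNReal.ofReal y := by
        rwa [ENNReal.lt_ofReal_iff_toReal_lt (hfx x)]
      filter_upwards [hf_usc x _ h1] with z hz
      exact (ENNReal.lt_ofReal_iff_toReal_lt (hfx z)).1 hz
    obtain ⟨θ, h1, h2, hθ⟩ := ConvexOrderDuality.exists_intermediate_measure hμν.order husc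
      (C := C) fun x => by
        rw [abs_of_nonneg ENNReal.toReal_nonneg]
        exact ENNReal.toReal_le_coe_of_le_coe (hC x)
    have := h1.finite_right
    have hne : ∫⁻ x, f x ∂θ ≠ ⊤ := by
      refine ((lintegral_mono hC).trans_lt ?_).ne
      rw [lintegral_const]
      exact ENNReal.mul_lt_top ENNReal.coe_lt_top (measure_lt_top _ _)
    have hval : ((∫ x, (f x).toReal ∂θ : ℝ) : EReal) ≤
        ((ConvexOrderDuality.auxPrimal μ ν f : ℝ≥0∞) : EReal) := by
      rw [integral_toReal hfm.aemeasurable (ae_of_all _ fun x => lt_top_iff_ne_top.2 (hfx x)),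
        EReal.coe_ennreal_toReal hne, EReal.coe_ennreal_le_coe_ennreal_iff,
        ← ConvexOrderDuality.outerIntegral_eq_lintegral θ hfm]
      exact le_iSup_of_le θ (le_iSup_of_le h1 (le_iSup_of_le h2 le_rfl))
    refine le_trans ?_ hval
    -- Testing with reals below the dual value avoids any prior knowledge that it is finite.
    refine EReal.ge_of_forall_gt_iff_ge.1 fun c hc => ?_
    rw [EReal.coe_le_coe_iff]
    refine hθ c fun φ ψ hφ hψ hφg hψg hle => ?_
    exact EReal.coe_le_coe_iff.1 (hc.le.trans (hμν.auxDual_le hfx hφ hψ hφg hψg hle))
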